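/- Identify $\Lambda=\mathbb R^3$ with the pure quaternions $z=x_1\mathbf i+x_2\mathbf j+x_3\mathbf k$, and let $\mu$ be the Gaussian probability measure on $\Lambda$ with density $(2\pi)^{-3/2}e^{-|z|^2/2}$ with respect to Lebesgue measure. On the right $\mathbb H$-module of polynomial functions $\sum_k z^k a_k$ ($a_k\in\mathbb H$) on $\Lambda$ put $\langle u,w\rangle=\int_\Lambda \overline{u(z)}\,w(z)\,d\mu(z)$. Let $P_n$ ($n\ge 0$) be the monic orthogonal polynomials for this scalar product (obtained from $1,z,z^2,\dots$ by the Gram–Schmidt process), let $h_n=\langle P_n,P_n\rangle$, and let $Q_n\in\mathbb R[s]$ be determined by $P_n(us)=u^nQ_n(s)$ for all unit pure quaternions $u$ and all real $s$. Put $$\rho_n(s,t)=\frac{Q_n(s)Q_{n+1}(t)-Q_{n+1}(s)Q_n(t)}{h_n\,(t-s)},\qquad \delta_n(s,t)=\frac{Q_n(s)Q_{n+1}(t)+Q_{n+1}(s)Q_n(t)}{h_n\,(t+s)} .$$ Write $\mathrm{ac}(x)=\sin 2x-2x$ and, for given $n,s,t$, $$\phi=\arccos\frac{s}{2\sqrt{n+3/2}},\quad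 \psi=\arccos\frac{t}{2\sqrt{n+3/2}},\quad D_n=\frac{n+3/2}{2}\big(\mathrm{ac}(\phi)-\mathrm{ac}(\psi)\big),\quad S_n=\frac{n+3/2}{2}\big(\mathrm{ac}(\phi)+\mathrm{ac}(\psi)\big).$$ **Theorem.** For every $\varepsilon>0$ there is a constant $C=C(\varepsilon)$ such that for all integers $n\ge 1$ and all $s,t\in[\varepsilon\sqrt n,(2-\varepsilon)\sqrt n]$ with $s\ne t$, $$\rho_n(s,t)e^{-\frac{s^2+t^2}{4}}=\sqrt{\frac2\pi}\,\frac18\Big(n+\frac32\Big)^{-3/2}\frac{1}{(\cos\phi-\cos\psi)\cos\phi\cos\psi\sqrt{\sin\phi\sin\psi}}\times\frac12\Big\{\cos(D_n-\phi)-\cos(D_n+\psi)+\sin(S_n-\psi)-\sin(S_n-\phi)+r\Big\}$$ with some $r=r_n(s,t)$ satisfying $|r|\le C\,n^{-1/2}$, and $$\big|\delta_n(s,t)\big|\,e^{-\frac{s^2+t^2}{4}}\le \frac{C}{n}.$$ -/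

import Mathlib

open scoped Quaternion Polynomial

namespace Ginibre3D

/-- The space `Λ = ℝ³` of imaginary quaternions. -/
abbrev Lam : Type := EuclideanSpace ℝ (Fin 3)

/-- The identification of `Λ = ℝ³` with the pure quaternions: `x ↦ x₁ i + x₂ j + x₃ k`. -/
def toQuat (x : Lam) : ℍ[ℝ] := ⟨0, x 0, x 1, x 2⟩

/-- The background measure `dμ(z) = (2π)^{-3/2} e^{-|z|²/2} dm(z)` on `Λ`. -/
noncomputable def bgMeasure : MeasureTheory.Measure Lam :=
  MeasureTheory.volume.withDensity fun z =>
    ENNReal.ofReal ((2 * Real.pi) ^ (-(3 / 2) : ℝ) * Real.exp (-‖z‖ ^ 2 / 2))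

/-- The quaternion-valued scalar product `⟨u, w⟩ = ∫_Λ conj(u(z)) w(z) dμ(z)`. -/
noncomputable def ip (u w : Lam → ℍ[ℝ]) : ℍ[ℝ] :=
  ∫ z, star (u z) * w z ∂bgMeasure

/-- The monic orthogonal polynomials `P_n` on `Λ`, obtained from `1, z, z², …` by the
Gram-Schmidt process in the right `ℍ`-module of polynomial functions:
`P_n = zⁿ - ∑_{k<n} P_k ⟨P_k, P_k⟩⁻¹ ⟨P_k, zⁿ⟩`. -/
noncomputable def P (n : ℕ) : Lam → ℍ[ℝ] := fun z =>
  toQuat z ^ n - ∑ k : Fin n, P k z * ((ip (P k) (P k))⁻¹ * ip (P k) (fun w => toQuat w ^ n))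
termination_by n
decreasing_by all_goals exact k.2

/-- The squared norm `h_n = ⟨P_n, P_n⟩`, a real number. -/
noncomputable def h (n : ℕ) : ℝ := (ip (P n) (P n)).re

/-! ### Existence of the real polynomials `Q_n` with `P_n(us) = uⁿ Q_n(s)` -/

theorem toQuat_re (x : Lam) : (toQuat x).re = 0 := rfl
theorem toQuat_imI (x : Lam) : (toQuat x).imI = x 0 := rfl
theorem toQuat_imJ (x : Lam) : (toQuat x).imJ = x 1 := rfl
theorem toQuat_imK (x : Lam) : (toQuat x).imK = x 2 := rfl

theorem toQuat_smul (s : ℝ) (u : Lam) : toQuat (s • u) = (s : ℍ[ℝ]) * toQuat u := by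
  ext <;> simp [toQuat_re, toQuat_imI, toQuat_imJ, toQuat_imK]

theorem toQuat_sq {u : Lam} (hu : ‖u‖ = 1) : toQuat u * toQuat u = -1 := by
  have h1 : u 0 ^ 2 + u 1 ^ 2 + u 2 ^ 2 = 1 := by
    have := EuclideanSpace.real_norm_sq_eq u
    rw [hu, Fin.sum_univ_three] at this
    linarith
  ext <;> simp [toQuat_re, toQuat_imI, toQuat_imJ, toQuat_imK]
  · linarith
  all_goals ring

theorem toQuat_neg (u : Lam) : toQuat (-u) = -toQuat u := by
  ext <;> simp [toQuat_re, toQuat_imI, toQuat_imJ, toQuat_imK]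

theorem star_toQuat (u : Lam) : star (toQuat u) = -toQuat u := by
  ext <;> simp [toQuat_re, toQuat_imI, toQuat_imJ, toQuat_imK]

theorem exists_polar (z : Lam) : ∃ (s : ℝ) (u : Lam), ‖u‖ = 1 ∧ z = s • u := by
  by_cases hz : z = 0
  · exact ⟨0, EuclideanSpace.single 0 1, by simp, by simp [hz]⟩
  · refine ⟨‖z‖, ‖z‖⁻¹ • z, ?_, ?_⟩
    · rw [norm_smul, norm_inv, norm_norm, inv_mul_cancel₀ (norm_ne_zero_iff.2 hz)]
    · rw [smul_smul, mul_inv_cancel₀ (norm_ne_zero_iff.2 hz), one_smul]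

/-- `F(us) = uⁿ q(s)` for every unit pure quaternion `u` and every real `s`. -/
def HasRadial (n : ℕ) (F : Lam → ℍ[ℝ]) (q : ℝ[X]) : Prop :=
  ∀ (u : Lam) (s : ℝ), ‖u‖ = 1 → F (s • u) = toQuat u ^ n * ((q.eval s : ℝ) : ℍ[ℝ])

theorem hasRadial_pow (n : ℕ) : HasRadial n (fun w => toQuat w ^ n) (Polynomial.X ^ n) := by
  intro u s _
  simp only [toQuat_smul, Polynomial.eval_pow, Polynomial.eval_X]
  rw [(Quaternion.coe_commute s (toQuat u)).mul_pow, Quaternion.coe_pow]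
  exact ((Quaternion.coe_commute s (toQuat u)).pow_pow n n).eq

theorem ip_integrand {m n : ℕ} {F G : Lam → ℍ[ℝ]} {p q : ℝ[X]}
    (hF : HasRadial m F p) (hG : HasRadial n G q) (u : Lam) (s : ℝ) (hu : ‖u‖ = 1) :
    star (F (s • u)) * G (s • u) =
      ((p.eval s * q.eval s * (-1) ^ m : ℝ) : ℍ[ℝ]) * toQuat u ^ (m + n) := by
  rw [hF u s hu, hG u s hu, star_mul, star_pow, star_toQuat, Quaternion.star_coe, neg_pow, pow_add]
  have h1 := (Quaternion.coe_commutes (q.eval s) (toQuat u ^ n)).symm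
  push_cast
  have h2 : ((-1 : ℍ[ℝ]) ^ m) = (((-1) ^ m : ℝ) : ℍ[ℝ]) := by simp
  rw [h1, h2]
  have h3 := Quaternion.coe_commutes (q.eval s) (((-1) ^ m : ℝ) * toQuat u ^ m : ℍ[ℝ])
  simp only [mul_assoc] at *
  rw [← mul_assoc (toQuat u ^ m), ← Quaternion.coe_commutes (q.eval s) (toQuat u ^ m)]
  simp only [← mul_assoc]
  have h4 := Quaternion.coe_commutes (q.eval s) ((((-1) ^ m : ℝ)) : ℍ[ℝ])
  simp only [mul_assoc]
  rw [← mul_assoc _ ((q.eval s : ℝ) : ℍ[ℝ]), ← h4]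
  simp [mul_assoc]

theorem toQuat_pow_even {u : Lam} (hu : ‖u‖ = 1) (m : ℕ) :
    toQuat u ^ (2 * m) = (((-1) ^ m : ℝ) : ℍ[ℝ]) := by
  rw [pow_mul, sq, toQuat_sq hu]; simp

theorem ip_real {m n : ℕ} {F G : Lam → ℍ[ℝ]} {p q : ℝ[X]}
    (hF : HasRadial m F p) (hG : HasRadial n G q) (hmn : Even (m + n)) :
    ∃ c : ℝ, ip F G = (c : ℍ[ℝ]) := by
  let L : ℝ →ₗᵢ[ℝ] ℍ[ℝ] :=
    ⟨Algebra.linearMap ℝ ℍ[ℝ], fun x => by simp⟩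
  have hL : ∀ x : ℝ, L x = (x : ℍ[ℝ]) := fun _ => rfl
  refine ⟨∫ z, (star (F z) * G z).re ∂bgMeasure, ?_⟩
  rw [← hL, ← L.integral_comp_comm, ip]
  congr 1
  funext z
  obtain ⟨s, u, hu, rfl⟩ := exists_polar z
  obtain ⟨k, hk⟩ := hmn
  rw [ip_integrand hF hG u s hu, hk, ← two_mul, toQuat_pow_even hu, ← Quaternion.coe_mul,
    hL, Quaternion.re_coe]

theorem ip_zero {m n : ℕ} {F G : Lam → ℍ[ℝ]} {p q : ℝ[X]}
    (hF : HasRadial m F p) (hG : HasRadial n G q) (hmn : Odd (m + n)) : ip F G = 0 := by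
  have hodd : ∀ z, star (F (-z)) * G (-z) = -(star (F z) * G z) := by
    intro z
    obtain ⟨s, u, hu, rfl⟩ := exists_polar z
    rw [← smul_neg, ip_integrand hF hG u s hu, ip_integrand hF hG (-u) s (by rwa [norm_neg]),
      toQuat_neg, hmn.neg_pow, mul_neg]
  unfold ip bgMeasure
  rw [integral_withDensity_eq_integral_toReal_smul (by fun_prop) (by simp)]
  set g : Lam → ℍ[ℝ] := fun z => (ENNReal.ofReal ((2 * Real.pi) ^ (-(3 / 2) : ℝ) *
    Real.exp (-‖z‖ ^ 2 / 2))).toReal • (star (F z) * G z) with hg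
  have h1 := MeasureTheory.integral_neg_eq_self g MeasureTheory.volume
  have h2 : ∀ z, g (-z) = -g z := by
    intro z; simp only [hg, hodd, norm_neg, smul_neg]
  simp only [h2, MeasureTheory.integral_neg] at h1
  have h3 : (2 : ℝ) • (∫ z, g z) = 0 := by
    rw [two_smul]
    nth_rewrite 1 [← h1]
    exact neg_add_cancel _
  exact (smul_eq_zero.1 h3).resolve_left two_ne_zero

theorem exists_radial (n : ℕ) : ∃ q : ℝ[X], HasRadial n (P n) q := by
  induction n using Nat.strong_induction_on with
  | _ n ih =>
    have key : ∀ k : Fin n, ∃ r : ℝ[X], HasRadial n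
        (fun z => P k z * ((ip (P k) (P k))⁻¹ * ip (P k) (fun w => toQuat w ^ n))) r := by
      intro k
      obtain ⟨q, hq⟩ := ih k k.2
      rcases Nat.even_or_odd (k + n : ℕ) with he | ho
      · obtain ⟨a, ha⟩ := ip_real hq hq (by simp)
        obtain ⟨b, hb⟩ := ip_real hq (hasRadial_pow n) he
        obtain ⟨m, hm⟩ : ∃ m, n = k + 2 * m := by
          obtain ⟨j, hj⟩ := he
          exact ⟨j - k, by have := k.2; omega⟩
        refine ⟨Polynomial.C ((-1) ^ m * (a⁻¹ * b)) * q, ?_⟩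
        intro u s hu
        have hsplit : toQuat u ^ n = toQuat u ^ (k : ℕ) * (((-1) ^ m : ℝ) : ℍ[ℝ]) := by
          rw [← toQuat_pow_even hu, ← pow_add, ← hm]
        simp only [ha, hb, hq u s hu]
        rw [hsplit, mul_assoc, mul_assoc]
        congr 1
        rw [← Quaternion.coe_inv, ← Quaternion.coe_mul, ← Quaternion.coe_mul, ← Quaternion.coe_mul,
          Polynomial.eval_mul, Polynomial.eval_C]
        congr 1
        have : ((-1 : ℝ) ^ m) * (-1) ^ m = 1 := by rw [← mul_pow]; simp
        linear_combination (-(a⁻¹ * b * q.eval s)) * this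
      · refine ⟨0, ?_⟩
        intro u s hu
        simp [ip_zero hq (hasRadial_pow n) ho]
    choose r hr using key
    refine ⟨Polynomial.X ^ n - ∑ k, r k, ?_⟩
    intro u s hu
    rw [P]
    have h0 := hasRadial_pow n u s hu
    have h1 : ∀ k : Fin n, _ := fun k => hr k u s hu
    simp only [] at h0 h1
    rw [h0, Finset.sum_congr rfl fun k _ => h1 k, ← Finset.mul_sum, ← mul_sub]
    congr 1
    rw [Polynomial.eval_sub, Polynomial.eval_finsetSum, Quaternion.coe_sub]
    congr 1
    exact (map_sum (algebraMap ℝ ℍ[ℝ]) _ _).symm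

/-- The polynomial `Q_n`, determined by `P_n(us) = uⁿ Q_n(s)` for all unit pure quaternions `u`
and all real `s`. -/
noncomputable def Q (n : ℕ) : ℝ[X] := (exists_radial n).choose

theorem P_eq_Q (n : ℕ) (u : Lam) (s : ℝ) (hu : ‖u‖ = 1) :
    P n (s • u) = toQuat u ^ n * (((Q n).eval s : ℝ) : ℍ[ℝ]) :=
  (exists_radial n).choose_spec u s hu

/-- `ρ_n(s,t)`, for `s ≠ t`. -/
noncomputable def rho (n : ℕ) (s t : ℝ) : ℝ :=
  ((Q n).eval s * (Q (n + 1)).eval t - (Q (n + 1)).eval s * (Q n).eval t) / (h n * (t - s))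

/-- `δ_n(s,t)`, for `s + t ≠ 0`. -/
noncomputable def delta (n : ℕ) (s t : ℝ) : ℝ :=
  ((Q n).eval s * (Q (n + 1)).eval t + (Q (n + 1)).eval s * (Q n).eval t) / (h n * (t + s))

/-- The angle `arccos (s / (2 √(n + 3/2)))`. -/
noncomputable def angle (n : ℕ) (s : ℝ) : ℝ :=
  Real.arccos (s / (2 * Real.sqrt (n + 3 / 2)))

/-- `ac x = sin 2x - 2x`. -/
noncomputable def ac (x : ℝ) : ℝ := Real.sin (2 * x) - 2 * x

/-- The difference phase `(n + 3/2)/2 · (ac φ - ac ψ)`. -/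
noncomputable def daleth (n : ℕ) (φ ψ : ℝ) : ℝ := ((n : ℝ) + 3 / 2) / 2 * (ac φ - ac ψ)

/-- The sum phase `(n + 3/2)/2 · (ac φ + ac ψ)`. -/
noncomputable def shin (n : ℕ) (φ ψ : ℝ) : ℝ := ((n : ℝ) + 3 / 2) / 2 * (ac φ + ac ψ)

end Ginibre3D

/-! On a ray through a unit pure quaternion `u` one has `u² = -1`, so products of functions of the
form `uⁿ q(s)` integrate to zero when the total power of `u` is odd, and otherwise to a sign times a
radial Gaussian moment. The Gram–Schmidt process on `Λ` is therefore the scalar one for the even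
weight `s² e^{-s²/2}` on the line: `Q_n` is a generalized Hermite polynomial (`Q_eq_genHermite`),
and `h_n` is a product of recurrence coefficients (`h_eq_normSq`).

Via the Dunkl operator these polynomials reduce to ordinary Hermite polynomials: `s Q_n = He_{n+1}`
for even `n`, and `s² Q_n = s He_{n+1} + He_n` for odd `n` (`genHermite_eq_realHermite`). The
function `w = He_{n+1} e^{-x²/4}` solves `w'' = (x²/4 - K) w` with `K = n + 3/2`, which is where the
`3/2` of the theorem comes from.

In Liouville–Green variables `w` and `w'` form a complex amplitude whose logarithmic derivative has
size `O(n^{-3/2})` on `[0, s]`, an interval of length `O(√n)`. By Gronwall the amplitude moves by a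
relative `O(1/n)` from its value at `0` (`norm_lgCoeff_sub_le`). That value is explicit, and the
Wallis product turns it into `R² / h_n = √(2/π) + O(1/n)` (`exists_amplitude`).

With `Φ = (K/2) ac θ + π/4`, where `θ` is the angle of `s`, this makes `s Q_n` and `s Q_{n+1}`
proportional to `cos Φ` and `cos (Φ - θ)` up to `O(1/n)` (`exists_bulk_asymptotics`). Product-to-sum
formulas give the four oscillating terms of `ρ_n`. For `δ_n` only boundedness of the cosines is
needed, since `s t (s + t)` has order `n^{3/2}`. -/

namespace Ginibre3D

/-- The recurrence coefficients `n + (1 - (-1)ⁿ)` of the generalized Hermite polynomials. -/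
noncomputable def beta (n : ℕ) : ℝ := n + if Even n then 0 else 2

/-- The even moments `(i + 1)‼` of the radial weight; the odd ones vanish. -/
noncomputable def radialMoment (i : ℕ) : ℝ := if Even i then ((i + 1).doubleFactorial : ℝ) else 0

/-- The moment functional of the weight `s² e^{-s²/2}`, normalized to be `1` at `1`. -/
noncomputable def mom : ℝ[X] →ₗ[ℝ] ℝ :=
  Polynomial.lsum fun i => radialMoment i • LinearMap.id

/-- The Dunkl operator `f ↦ f' + (f(x) - f(-x)) / x`. -/
noncomputable def dunkl : ℝ[X] →ₗ[ℝ] ℝ[X] :=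
  Polynomial.lsum fun i => beta i • Polynomial.monomial (i - 1)

/-- The monic orthogonal polynomials for the weight `s² e^{-s²/2}`. -/
noncomputable def genHermite : ℕ → ℝ[X]
  | 0 => 1
  | n + 1 => Polynomial.X * genHermite n - dunkl (genHermite n)

/-- The squared norms of the generalized Hermite polynomials. -/
noncomputable def normSq (n : ℕ) : ℝ := ∏ k ∈ Finset.range n, beta (k + 1)

/-! ### Orthogonality of the generalized Hermite polynomials, in terms of moments -/

section Algebra

open Polynomial

theorem mom_monomial (i : ℕ) (a : ℝ) : mom (monomial i a) = a * radialMoment i := by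
  simp [mom, lsum_apply, sum_monomial_index, mul_comm]

theorem mom_X_pow (i : ℕ) : mom (X ^ i) = radialMoment i := by
  rw [← monomial_one_right_eq_X_pow, mom_monomial, one_mul]

theorem dunkl_monomial (i : ℕ) (a : ℝ) : dunkl (monomial i a) = monomial (i - 1) (beta i * a) := by
  simp [dunkl, lsum_apply, sum_monomial_index, smul_monomial]

theorem beta_pos {n : ℕ} (hn : 0 < n) : 0 < beta n := by
  have : (0 : ℝ) < n := by exact_mod_cast hn
  unfold beta; split_ifs <;> linarith

theorem normSq_pos (n : ℕ) : 0 < normSq n :=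
  Finset.prod_pos fun k _ => beta_pos k.succ_pos

theorem normSq_succ (n : ℕ) : normSq (n + 1) = beta (n + 1) * normSq n := by
  rw [normSq, Finset.prod_range_succ, mul_comm, normSq]

theorem radialMoment_add_two (i : ℕ) : radialMoment (i + 2) = (i + 3) * radialMoment i := by
  unfold radialMoment
  by_cases hi : Even i
  · rw [if_pos hi, if_pos (by simpa [Nat.even_add] using hi), Nat.doubleFactorial]
    push_cast; ring
  · rw [if_neg hi, if_neg (by simpa [Nat.even_add] using hi), mul_zero]

theorem radialMoment_of_not_even {i : ℕ} (hi : ¬ Even i) : radialMoment i = 0 := if_neg hi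

theorem beta_zero : beta 0 = 0 := by simp [beta]

theorem beta_add_one_of_even {i : ℕ} (hi : Even i) : beta (i + 1) = i + 3 := by
  rw [beta, if_neg (by simpa [Nat.even_add_one] using hi)]
  push_cast; ring

/-- All three moments have indices of the same parity. If it is odd they vanish; if it is even and
both `k, j ≥ 1`, exactly one of `k`, `j` is odd, so `beta k + beta j = k + j + 2`, the factor in the
moment recursion. Truncated subtraction at index `0` is harmless because `beta 0 = 0`. -/
theorem radialMoment_raise (k j : ℕ) :
    radialMoment (k + j + 1) - beta j * radialMoment (k + (j - 1)) =
      beta k * radialMoment (k - 1 + j) := by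
  rcases k with _ | l
  · rcases j with _ | i
    · simp [beta_zero, radialMoment]
    · rw [show 0 + (i + 1) + 1 = i + 2 by ring, show 0 + (i + 1 - 1) = i by omega,
        radialMoment_add_two, beta_zero]
      by_cases hi : Even i
      · rw [beta_add_one_of_even hi]; ring
      · rw [radialMoment_of_not_even hi]; ring
  · rcases j with _ | i
    · rw [show l + 1 + 0 + 1 = l + 2 by ring, show l + 1 - 1 + 0 = l by omega,
        radialMoment_add_two, beta_zero]
      by_cases hi : Even l
      · rw [beta_add_one_of_even hi]; ring
      · rw [radialMoment_of_not_even hi]; ring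
    · rw [show l + 1 + (i + 1) + 1 = l + i + 1 + 2 by ring,
        show l + 1 + (i + 1 - 1) = l + i + 1 by omega,
        show l + 1 - 1 + (i + 1) = l + i + 1 by omega, radialMoment_add_two]
      by_cases hi : Even (l + i + 1)
      · have h4 : beta (l + 1) + beta (i + 1) = l + i + 4 := by
          rw [add_assoc, Nat.even_add] at hi
          by_cases hl : Even l
          · rw [beta_add_one_of_even hl, beta, if_pos (hi.1 hl)]; push_cast; ring
          · have h5 : Even i := by
              have := mt hi.2 hl
              simpa [Nat.even_add_one] using this
            rw [beta_add_one_of_even h5, beta, if_pos (by simpa [Nat.even_add_one] using hl)]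
            push_cast; ring
        push_cast
        linear_combination (-radialMoment (l + i + 1)) * h4
      · rw [radialMoment_of_not_even hi]; ring

theorem mom_C_mul_X_pow (i : ℕ) (a : ℝ) : mom (C a * X ^ i) = a * radialMoment i := by
  rw [C_mul_X_pow_eq_monomial, mom_monomial]

theorem dunkl_C_mul_X_pow (i : ℕ) (a : ℝ) :
    dunkl (C a * X ^ i) = C (beta i * a) * X ^ (i - 1) := by
  rw [C_mul_X_pow_eq_monomial, dunkl_monomial, C_mul_X_pow_eq_monomial]

/-- The raising operator is adjoint to the Dunkl operator. -/
theorem mom_X_pow_mul_raise (k : ℕ) (g : ℝ[X]) :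
    mom (X ^ k * (X * g - dunkl g)) = beta k * mom (X ^ (k - 1) * g) := by
  induction g using Polynomial.induction_on' with
  | add p q hp hq =>
    have h1 : X ^ k * (X * (p + q) - dunkl (p + q)) =
        X ^ k * (X * p - dunkl p) + X ^ k * (X * q - dunkl q) := by
      rw [map_add]; ring
    rw [h1, map_add, hp, hq, mul_add, map_add, mul_add]
  | monomial j a =>
    have h1 : X ^ k * (X * (C a * X ^ j) - C (beta j * a) * X ^ (j - 1)) =
        C a * X ^ (k + j + 1) - C (beta j * a) * X ^ (k + (j - 1)) := by
      rw [pow_add X k (j - 1)]; ring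
    have h2 : X ^ (k - 1) * (C a * X ^ j) = C a * X ^ (k - 1 + j) := by ring
    rw [← C_mul_X_pow_eq_monomial, dunkl_C_mul_X_pow, h1, h2, map_sub, mom_C_mul_X_pow,
      mom_C_mul_X_pow, mom_C_mul_X_pow]
    linear_combination a * radialMoment_raise k j

/-- Each raising step moves onto `X ^ k` as a lowering by one with factor `beta k`. With fewer
powers than raising steps, the factor `beta 0 = 0` eventually appears; with equally many, the
factors multiply to `normSq n`. -/
theorem mom_X_pow_mul_genHermite_of_lt {n k : ℕ} (hk : k < n) :
    mom (X ^ k * genHermite n) = 0 := by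
  induction n generalizing k with
  | zero => omega
  | succ n ih =>
    rw [genHermite, mom_X_pow_mul_raise]
    rcases Nat.eq_zero_or_pos k with rfl | hk0
    · rw [beta_zero, zero_mul]
    · rw [ih (by omega), mul_zero]

theorem mom_X_pow_mul_genHermite_self (n : ℕ) : mom (X ^ n * genHermite n) = normSq n := by
  induction n with
  | zero => rw [genHermite, mul_one, mom_X_pow]; simp [radialMoment, normSq]
  | succ n ih =>
    rw [genHermite, mom_X_pow_mul_raise, Nat.add_sub_cancel, ih, normSq_succ]

theorem natDegree_dunkl_le (f : ℝ[X]) : (dunkl f).natDegree ≤ f.natDegree := by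
  rw [dunkl, lsum_apply, Polynomial.sum]
  refine natDegree_sum_le_of_forall_le _ _ fun i hi => ?_
  simp only [LinearMap.smul_apply, smul_monomial]
  exact (natDegree_monomial_le _).trans ((Nat.sub_le _ _).trans (le_natDegree_of_mem_supp i hi))

theorem genHermite_monic_natDegree (n : ℕ) :
    (genHermite n).Monic ∧ (genHermite n).natDegree = n := by
  induction n with
  | zero => exact ⟨monic_one, natDegree_one⟩
  | succ n ih =>
    obtain ⟨hm, hd⟩ := ih
    have h1 : (X * genHermite n).Monic := monic_X.mul hm
    have h2 : (X * genHermite n).natDegree = n + 1 := by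
      rw [monic_X.natDegree_mul hm, natDegree_X, hd, add_comm]
    have h3 : (dunkl (genHermite n)).degree < (X * genHermite n).degree := by
      rw [degree_eq_natDegree h1.ne_zero, h2]
      refine (degree_le_natDegree).trans_lt ?_
      have := natDegree_dunkl_le (genHermite n)
      exact_mod_cast (by omega : (dunkl (genHermite n)).natDegree < n + 1)
    rw [genHermite]
    refine ⟨h1.sub_of_left h3, ?_⟩
    rw [natDegree_sub_eq_left_of_natDegree_lt, h2]
    have := natDegree_dunkl_le (genHermite n)
    omega

theorem mom_mul_eq_sum (f g : ℝ[X]) :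
    mom (f * g) = ∑ i ∈ Finset.range (f.natDegree + 1), f.coeff i * mom (X ^ i * g) := by
  conv_lhs => rw [f.as_sum_range_C_mul_X_pow]
  rw [Finset.sum_mul, map_sum]
  refine Finset.sum_congr rfl fun i _ => ?_
  rw [mul_assoc, ← smul_eq_C_mul, map_smul, smul_eq_mul]

theorem mom_mul_genHermite_of_natDegree_lt {n : ℕ} {f : ℝ[X]} (hf : f.natDegree < n) :
    mom (f * genHermite n) = 0 := by
  rw [mom_mul_eq_sum]
  refine Finset.sum_eq_zero fun i hi => ?_
  rw [mom_X_pow_mul_genHermite_of_lt (by have := Finset.mem_range.1 hi; omega), mul_zero]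

theorem mom_mul_genHermite_natDegree (f : ℝ[X]) :
    mom (f * genHermite f.natDegree) = f.leadingCoeff * normSq f.natDegree := by
  rw [mom_mul_eq_sum, Finset.sum_range_succ, mom_X_pow_mul_genHermite_self, Finset.sum_eq_zero,
    zero_add, leadingCoeff]
  intro i hi
  rw [mom_X_pow_mul_genHermite_of_lt (Finset.mem_range.1 hi), mul_zero]

theorem mom_genHermite_mul_self (n : ℕ) : mom (genHermite n * genHermite n) = normSq n := by
  have h := mom_mul_genHermite_natDegree (genHermite n)
  rwa [(genHermite_monic_natDegree n).2, (genHermite_monic_natDegree n).1.leadingCoeff,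
    one_mul] at h

theorem mom_genHermite_mul_of_ne {m n : ℕ} (hmn : m ≠ n) :
    mom (genHermite m * genHermite n) = 0 := by
  rcases lt_or_gt_of_ne hmn with h | h
  · exact mom_mul_genHermite_of_natDegree_lt (by rwa [(genHermite_monic_natDegree m).2])
  · rw [mul_comm]
    exact mom_mul_genHermite_of_natDegree_lt (by rwa [(genHermite_monic_natDegree n).2])

/-- Pairing `f` with the orthogonal polynomial of its own degree isolates the leading coefficient.
-/
theorem eq_zero_of_mom_mul_genHermite {n : ℕ} {f : ℝ[X]} (hf : f.degree < (n : WithBot ℕ))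
    (h : ∀ k < n, mom (f * genHermite k) = 0) : f = 0 := by
  by_contra h0
  have h1 : f.natDegree < n := by rwa [natDegree_lt_iff_degree_lt h0]
  have h2 := mom_mul_genHermite_natDegree f
  rw [h _ h1] at h2
  rcases mul_eq_zero.1 h2.symm with h3 | h3
  · exact h0 (leadingCoeff_eq_zero.1 h3)
  · exact (normSq_pos _).ne' h3

/-- The Gram–Schmidt process for the moment functional yields the generalized Hermite
polynomials. -/
theorem genHermite_eq_gramSchmidt (n : ℕ) :
    genHermite n = X ^ n - ∑ k ∈ Finset.range n,
      C ((normSq k)⁻¹ * mom (genHermite k * X ^ n)) * genHermite k := by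
  have hsum : (∑ k ∈ Finset.range n,
      C ((normSq k)⁻¹ * mom (genHermite k * X ^ n)) * genHermite k).degree < (n : WithBot ℕ) := by
    refine (degree_sum_le _ _).trans_lt ((Finset.sup_lt_iff (WithBot.bot_lt_coe n)).2 ?_)
    intro k hk
    rw [← smul_eq_C_mul]
    refine (degree_smul_le _ _).trans_lt (degree_le_natDegree.trans_lt ?_)
    rw [(genHermite_monic_natDegree k).2]
    exact WithBot.coe_lt_coe.2 (Finset.mem_range.1 hk)
  have hq : (genHermite n - X ^ n).degree < (n : WithBot ℕ) := by
    obtain ⟨hm, hd⟩ := genHermite_monic_natDegree n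
    have h1 : (genHermite n).degree = n := by rw [degree_eq_natDegree hm.ne_zero, hd]
    rw [← h1]
    exact degree_sub_lt_left (by rw [h1, degree_X_pow]) hm.ne_zero
      (by rw [hm.leadingCoeff, (monic_X_pow n).leadingCoeff])
  refine sub_eq_zero.1 (eq_zero_of_mom_mul_genHermite (n := n) ?_ ?_)
  · rw [← sub_add]
    exact (degree_add_le _ _).trans_lt (max_lt hq hsum)
  · intro k hk
    rw [← sub_add, add_mul, sub_mul, map_add, map_sub, mom_genHermite_mul_of_ne hk.ne', zero_sub,
      Finset.sum_mul, map_sum, Finset.sum_eq_single k]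
    · rw [mul_assoc, ← smul_eq_C_mul, map_smul, mom_genHermite_mul_self, smul_eq_mul,
        mul_comm (genHermite k)]
      field_simp [(normSq_pos k).ne']
      ring
    · intro j _ hj
      rw [mul_assoc, ← smul_eq_C_mul, map_smul, mom_genHermite_mul_of_ne hj, smul_zero]
    · exact fun h => absurd (Finset.mem_range.2 hk) h

end Algebra

/-! ### Radial moments of the Gaussian measure on `ℝ³` -/

section Moments

open MeasureTheory Set

theorem integrableOn_pow_mul_exp (i : ℕ) :
    IntegrableOn (fun y : ℝ => y ^ i * Real.exp (-y ^ 2 / 2)) (Ioi 0) := by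
  have h := integrableOn_rpow_mul_exp_neg_mul_rpow (s := i) (p := 2) (b := 1 / 2)
    (by have : (0 : ℝ) ≤ i := i.cast_nonneg; linarith) (by norm_num) (by norm_num)
  refine h.congr_fun (fun y _ => ?_) measurableSet_Ioi
  simp only [Real.rpow_natCast, Real.rpow_ofNat]
  ring_nf

theorem integral_pow_add_two_mul_exp (i : ℕ) :
    ∫ y in Ioi (0 : ℝ), y ^ (i + 2) * Real.exp (-y ^ 2 / 2) =
      (i + 1) * ∫ y in Ioi (0 : ℝ), y ^ i * Real.exp (-y ^ 2 / 2) := by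
  have key : ∀ j : ℕ, ∫ y in Ioi (0 : ℝ), y ^ j * Real.exp (-y ^ 2 / 2) =
      (1 / 2 : ℝ) ^ (-((j : ℝ) + 1) / 2) * (1 / 2) * Real.Gamma (((j : ℝ) + 1) / 2) := by
    intro j
    rw [← integral_rpow_mul_exp_neg_mul_rpow (p := 2) (q := j) (b := 1 / 2) (by norm_num)
      (by have : (0 : ℝ) ≤ j := j.cast_nonneg; linarith) (by norm_num)]
    refine setIntegral_congr_fun measurableSet_Ioi fun y _ => ?_
    simp only [Real.rpow_natCast, Real.rpow_ofNat]
    ring_nf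
  rw [key, key]
  have hi : ((i : ℝ) + 1) / 2 ≠ 0 := by positivity
  have h1 : (((i + 2 : ℕ) : ℝ) + 1) / 2 = ((i : ℝ) + 1) / 2 + 1 := by push_cast; ring
  have h2 : -(((i + 2 : ℕ) : ℝ) + 1) / 2 = -((i : ℝ) + 1) / 2 - 1 := by push_cast; ring
  rw [h1, h2, Real.Gamma_add_one hi, Real.rpow_sub_one (by norm_num)]
  ring

theorem integrable_norm_pow (i : ℕ) : Integrable (fun z : Lam => ‖z‖ ^ i) bgMeasure := by
  rw [bgMeasure, integrable_withDensity_iff_integrable_smul' (by fun_prop) (by simp)]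
  have h : Integrable (fun z : Lam => ‖z‖ ^ i * Real.exp (-‖z‖ ^ 2 / 2)) := by
    rw [integrable_fun_norm_addHaar volume (f := fun y => y ^ i * Real.exp (-y ^ 2 / 2))]
    refine (integrableOn_pow_mul_exp (i + 2)).congr_fun (fun y _ => ?_) measurableSet_Ioi
    simp only [finrank_euclideanSpace, Fintype.card_fin, smul_eq_mul]
    ring
  refine (h.const_mul ((2 * Real.pi) ^ (-(3 / 2) : ℝ))).congr (Filter.Eventually.of_forall ?_)
  intro z
  simp only [smul_eq_mul]
  rw [ENNReal.toReal_ofReal (by positivity)]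
  ring

theorem integral_norm_pow_eq (i : ℕ) : ∫ z, ‖z‖ ^ i ∂bgMeasure =
    (2 * Real.pi) ^ (-(3 / 2) : ℝ) * ∫ z : Lam, ‖z‖ ^ i * Real.exp (-‖z‖ ^ 2 / 2) := by
  rw [bgMeasure, integral_withDensity_eq_integral_toReal_smul (by fun_prop) (by simp),
    ← integral_const_mul]
  congr 1
  funext z
  rw [ENNReal.toReal_ofReal (by positivity), smul_eq_mul]
  ring

/-- Polar coordinates contribute a factor `y²`, so the one-dimensional recursion is used at `i + 2`;
this turns `i + 1` into `i + 3`. -/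
theorem integral_norm_pow_add_two (i : ℕ) :
    ∫ z, ‖z‖ ^ (i + 2) ∂bgMeasure = (i + 3) * ∫ z, ‖z‖ ^ i ∂bgMeasure := by
  have key : ∀ j : ℕ, ∫ z : Lam, ‖z‖ ^ j * Real.exp (-‖z‖ ^ 2 / 2) =
      3 * ((volume : Measure Lam).real (Metric.ball 0 1) *
        ∫ y in Ioi (0 : ℝ), y ^ (j + 2) * Real.exp (-y ^ 2 / 2)) := by
    intro j
    rw [integral_fun_norm_addHaar volume (f := fun y => y ^ j * Real.exp (-y ^ 2 / 2))]
    simp only [finrank_euclideanSpace, Fintype.card_fin, smul_eq_mul, nsmul_eq_mul]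
    congr 2
    refine setIntegral_congr_fun measurableSet_Ioi fun y _ => ?_
    ring
  rw [integral_norm_pow_eq, integral_norm_pow_eq, key, key, integral_pow_add_two_mul_exp (i + 2)]
  push_cast
  ring

theorem integral_one_bgMeasure : ∫ z : Lam, ‖z‖ ^ 0 ∂bgMeasure = 1 := by
  rw [integral_norm_pow_eq]
  have h := GaussianFourier.integral_rexp_neg_mul_sq_norm (V := Lam) (b := 1 / 2) (by norm_num)
  have h2 : ∀ z : Lam, ‖z‖ ^ 0 * Real.exp (-‖z‖ ^ 2 / 2) = Real.exp (-(1 / 2) * ‖z‖ ^ 2) := by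
    intro z; rw [pow_zero, one_mul]; ring_nf
  simp only [h2, h, finrank_euclideanSpace, Fintype.card_fin]
  have h3 : Real.pi / (1 / 2) = 2 * Real.pi := by ring
  rw [h3]
  push_cast
  rw [← Real.rpow_add (by positivity)]
  norm_num

theorem integral_norm_pow_of_even {i : ℕ} (hi : Even i) :
    ∫ z, ‖z‖ ^ i ∂bgMeasure = radialMoment i := by
  obtain ⟨j, rfl⟩ := hi
  rw [← two_mul]
  induction j with
  | zero => rw [mul_zero, integral_one_bgMeasure]; simp [radialMoment]
  | succ j ih =>
    rw [mul_add, mul_one, integral_norm_pow_add_two, radialMoment_add_two, ih]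

theorem coeff_of_eval_neg {f : ℝ[X]} {c : ℝ} (hf : ∀ s : ℝ, f.eval (-s) = c * f.eval s) (i : ℕ) :
    f.coeff i * (-1) ^ i = c * f.coeff i := by
  have hc : f.comp (Polynomial.C (-1) * Polynomial.X) = Polynomial.C c * f :=
    Polynomial.funext fun s => by simpa using hf s
  rw [← Polynomial.comp_C_mul_X_coeff, hc, Polynomial.coeff_C_mul]

theorem mom_eq_sum_coeff (f : ℝ[X]) :
    mom f = ∑ i ∈ Finset.range (f.natDegree + 1), f.coeff i * radialMoment i := by
  have h := mom_mul_eq_sum f 1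
  simpa only [mul_one, mom_X_pow] using h

theorem mom_eq_zero_of_odd {f : ℝ[X]} (hf : ∀ s : ℝ, f.eval (-s) = -f.eval s) : mom f = 0 := by
  rw [mom_eq_sum_coeff]
  refine Finset.sum_eq_zero fun i _ => ?_
  by_cases hi : Even i
  · have h1 := coeff_of_eval_neg (c := -1) (by simpa using hf) i
    rw [hi.neg_one_pow] at h1
    rw [show f.coeff i = 0 by linarith, zero_mul]
  · rw [radialMoment_of_not_even hi, mul_zero]

/-- Evenness is essential: `mom` sends odd powers to zero, while odd powers of the norm have
positive integral. -/
theorem integral_eval_norm {f : ℝ[X]} (hf : ∀ s : ℝ, f.eval (-s) = f.eval s) :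
    ∫ z, f.eval ‖z‖ ∂bgMeasure = mom f := by
  simp only [Polynomial.eval_eq_sum_range]
  rw [integral_finsetSum _ fun i _ => (integrable_norm_pow i).const_mul _]
  simp only [integral_const_mul]
  rw [mom_eq_sum_coeff]
  refine Finset.sum_congr rfl fun i _ => ?_
  by_cases hi : Even i
  · rw [integral_norm_pow_of_even hi]
  · have h1 := coeff_of_eval_neg (c := 1) (by simpa using hf) i
    rw [(Nat.not_even_iff_odd.1 hi).neg_one_pow] at h1
    rw [show f.coeff i = 0 by linarith, zero_mul, zero_mul]

end Moments

/-! ### From quaternionic Gram–Schmidt to the scalar process -/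

section GramSchmidt

open Polynomial

theorem toQuat_ne_zero {u : Lam} (hu : ‖u‖ = 1) : toQuat u ≠ 0 := by
  intro h
  have := toQuat_sq hu
  rw [h, mul_zero] at this
  simp at this

/-- The pairs `(u, s)` and `(-u, -s)` describe the same point of `Λ`. -/
theorem HasRadial.eval_neg {n : ℕ} {F : Lam → ℍ[ℝ]} {q : ℝ[X]} (hF : HasRadial n F q) (s : ℝ) :
    q.eval (-s) = (-1) ^ n * q.eval s := by
  obtain ⟨u, hu⟩ : ∃ u : Lam, ‖u‖ = 1 := ⟨EuclideanSpace.single 0 1, by simp⟩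
  have h1 := hF (-u) (-s) (by rwa [norm_neg])
  rw [smul_neg, neg_smul, neg_neg, hF u s hu, toQuat_neg, neg_pow] at h1
  have h0 := toQuat_ne_zero hu
  have h2 : ((-1 : ℍ[ℝ]) ^ n) = (((-1) ^ n : ℝ) : ℍ[ℝ]) := by simp
  rw [h2, Quaternion.coe_commutes, mul_assoc] at h1
  have h3 := mul_left_cancel₀ (pow_ne_zero n h0) h1
  rw [← Quaternion.coe_mul] at h3
  have h4 := Quaternion.coe_injective h3
  rw [h4, ← mul_assoc, ← mul_pow]
  simp

theorem HasRadial.unique {n : ℕ} {F : Lam → ℍ[ℝ]} {p q : ℝ[X]} (hp : HasRadial n F p)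
    (hq : HasRadial n F q) : p = q := by
  obtain ⟨u, hu⟩ : ∃ u : Lam, ‖u‖ = 1 := ⟨EuclideanSpace.single 0 1, by simp⟩
  have h0 := toQuat_ne_zero hu
  refine Polynomial.funext fun s => ?_
  have h1 := hp u s hu
  rw [hq u s hu] at h1
  exact (Quaternion.coe_injective (mul_left_cancel₀ (pow_ne_zero n h0) h1)).symm

/-- Conjugating `u ^ m` gives the sign `(-1) ^ m`, and `u ^ (2 * j)` gives `(-1) ^ j`. What is left
is an even polynomial in the radius. -/
theorem ip_eq_mom {m n j : ℕ} {F G : Lam → ℍ[ℝ]} {p q : ℝ[X]} (hF : HasRadial m F p)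
    (hG : HasRadial n G q) (hmn : m + n = 2 * j) :
    ip F G = (((-1) ^ (m + j) * mom (p * q) : ℝ) : ℍ[ℝ]) := by
  let L : ℝ →ₗᵢ[ℝ] ℍ[ℝ] := ⟨Algebra.linearMap ℝ ℍ[ℝ], fun x => by simp⟩
  have hL : ∀ x : ℝ, L x = (x : ℍ[ℝ]) := fun _ => rfl
  have heven : ∀ s : ℝ, (p * q).eval (-s) = (p * q).eval s := by
    intro s
    have h1 : ((-1 : ℝ) ^ m) * (-1) ^ n = 1 := by rw [← pow_add, hmn, pow_mul]; simp
    rw [eval_mul, eval_mul, hF.eval_neg, hG.eval_neg]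
    linear_combination p.eval s * q.eval s * h1
  rw [← integral_eval_norm heven, ← MeasureTheory.integral_const_mul, ← hL,
    ← L.integral_comp_comm, ip]
  congr 1
  funext z
  have key : ∀ (s : ℝ) (u : Lam), ‖u‖ = 1 → star (F (s • u)) * G (s • u) =
      (((-1) ^ (m + j) * (p * q).eval s : ℝ) : ℍ[ℝ]) := by
    intro s u hu
    rw [ip_integrand hF hG u s hu, hmn, toQuat_pow_even hu, ← Quaternion.coe_mul, eval_mul,
      pow_add]
    congr 1
    ring
  obtain ⟨s, u, hu, rfl⟩ := exists_polar z
  rw [key s u hu, hL, norm_smul, hu, mul_one, Real.norm_eq_abs]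
  rcases abs_choice s with h | h <;> rw [h]
  rw [heven]

theorem hasRadial_P (n : ℕ) : HasRadial n (P n) (genHermite n) := by
  induction n using Nat.strong_induction_on with
  | _ n ih =>
    have key : ∀ k : Fin n, HasRadial n
        (fun z => P k z * ((ip (P k) (P k))⁻¹ * ip (P k) (fun w => toQuat w ^ n)))
        (C ((normSq k)⁻¹ * mom (genHermite k * X ^ n)) * genHermite k) := by
      intro k u s hu
      have hk := ih k k.2
      have ha : ip (P k) (P k) = ((normSq k : ℝ) : ℍ[ℝ]) := by
        rw [ip_eq_mom hk hk (two_mul _).symm, mom_genHermite_mul_self, ← two_mul, pow_mul]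
        simp
      rcases Nat.even_or_odd (k + n : ℕ) with he | ho
      · obtain ⟨m, hm⟩ : ∃ m, n = k + 2 * m := by
          obtain ⟨j, hj⟩ := he
          exact ⟨j - k, by have := k.2; omega⟩
        have hb : ip (P k) (fun w => toQuat w ^ n) =
            (((-1) ^ m * mom (genHermite k * X ^ n) : ℝ) : ℍ[ℝ]) := by
          rw [ip_eq_mom hk (hasRadial_pow n) (j := k + m) (by omega), ← add_assoc, ← two_mul,
            pow_add, pow_mul]
          simp
        -- This sign cancels the one in `hb`, so the quaternionic projection coefficient becomes the
        -- scalar one.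
        have hsplit : toQuat u ^ n = toQuat u ^ (k : ℕ) * (((-1) ^ m : ℝ) : ℍ[ℝ]) := by
          rw [← toQuat_pow_even hu, ← pow_add, ← hm]
        simp only [ha, hb, hk u s hu]
        rw [hsplit, mul_assoc, mul_assoc]
        congr 1
        rw [← Quaternion.coe_inv, ← Quaternion.coe_mul, ← Quaternion.coe_mul, ← Quaternion.coe_mul,
          eval_mul, eval_C]
        congr 1
        ring
      · have hb := ip_zero hk (hasRadial_pow n) ho
        have hmom : mom (genHermite k * X ^ n) = 0 := by
          refine mom_eq_zero_of_odd fun s => ?_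
          rw [eval_mul, eval_mul, hk.eval_neg, eval_pow, eval_pow, eval_X, eval_X, neg_pow s]
          have h1 : ((-1 : ℝ) ^ (k : ℕ)) * (-1) ^ n = -1 := by rw [← pow_add, ho.neg_one_pow]
          linear_combination (genHermite k).eval s * s ^ n * h1
        simp [hb, hmom]
    intro u s hu
    rw [P]
    have h0 := hasRadial_pow n u s hu
    have h1 : ∀ k : Fin n, _ := fun k => key k u s hu
    simp only [] at h0 h1
    rw [h0, Finset.sum_congr rfl fun k _ => h1 k, ← Finset.mul_sum, ← mul_sub]
    congr 1
    rw [genHermite_eq_gramSchmidt, eval_sub, Quaternion.coe_sub, ← Fin.sum_univ_eq_sum_range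
      (fun k => C ((normSq k)⁻¹ * mom (genHermite k * X ^ n)) * genHermite k), eval_finsetSum]
    congr 1
    exact (map_sum (algebraMap ℝ ℍ[ℝ]) _ _).symm

theorem Q_eq_genHermite (n : ℕ) : Q n = genHermite n :=
  HasRadial.unique (P_eq_Q n) (hasRadial_P n)

theorem h_eq_normSq (n : ℕ) : h n = normSq n := by
  rw [h, ip_eq_mom (hasRadial_P n) (hasRadial_P n) (two_mul n).symm, mom_genHermite_mul_self,
    ← two_mul, pow_mul]
  simp

end GramSchmidt

/-! ### Reduction to ordinary Hermite polynomials -/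

section Hermite

open Polynomial

/-- The probabilists' Hermite polynomials with real coefficients. -/
noncomputable def realHermite (k : ℕ) : ℝ[X] := (hermite k).map (Int.castRingHom ℝ)

theorem realHermite_succ (k : ℕ) :
    realHermite (k + 1) = X * realHermite k - derivative (realHermite k) := by
  simp [realHermite, hermite_succ, derivative_map]

theorem derivative_realHermite_succ (k : ℕ) :
    derivative (realHermite (k + 1)) = C ((k : ℝ) + 1) * realHermite k := by
  induction k with
  | zero => simp [realHermite]
  | succ k ih =>
    rw [realHermite_succ (k + 1), derivative_sub, derivative_mul, derivative_X, ih,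
      derivative_mul, derivative_C]
    have h := realHermite_succ k
    simp only [C_add, C_1, Nat.cast_add, Nat.cast_one]
    linear_combination (-(C (k : ℝ) + 1)) * h

/-- The Hermite equation, found by computing the derivative of `realHermite (k + 1)` in two ways. -/
theorem derivative_derivative_realHermite (k : ℕ) :
    derivative (derivative (realHermite k)) =
      X * derivative (realHermite k) - C (k : ℝ) * realHermite k := by
  have h1 := derivative_realHermite_succ k
  rw [realHermite_succ, derivative_sub, derivative_mul, derivative_X, C_add, C_1] at h1
  linear_combination -h1

theorem X_mul_dunkl (f : ℝ[X]) :
    X * dunkl f = X * derivative f + f - f.comp (C (-1) * X) := by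
  induction f using Polynomial.induction_on' with
  | add p q hp hq =>
    rw [map_add, mul_add, hp, hq, derivative_add, add_comp]; ring
  | monomial i a =>
    rw [← C_mul_X_pow_eq_monomial, dunkl_C_mul_X_pow, derivative_C_mul_X_pow, mul_comp, C_comp,
      pow_comp, X_comp, mul_pow, ← C_pow]
    rcases i with _ | i
    · simp [beta_zero]
    · rw [Nat.add_sub_cancel, beta]
      by_cases hi : Even (i + 1)
      · rw [if_pos hi, hi.neg_one_pow, add_zero, C_mul, C_mul, C_1]; ring
      · rw [if_neg hi, (Nat.not_even_iff_odd.1 hi).neg_one_pow, C_mul, C_mul, C_add, C_neg, C_1,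
          show C (2 : ℝ) = 2 by rfl]
        ring

theorem genHermite_comp_neg (n : ℕ) :
    (genHermite n).comp (C (-1) * X) = C ((-1) ^ n) * genHermite n :=
  Polynomial.funext fun s => by simpa using (hasRadial_P n).eval_neg s

/-- The two parities feed each other. Parity turns the reflection in `X_mul_dunkl` into a sign, so
the Dunkl operator is `f'` on even `f` and `f' + 2f/x` on odd `f`; differentiating the previous
relation then gives the next one. -/
theorem genHermite_eq_realHermite (n : ℕ) :
    (Even n → X * genHermite n = realHermite (n + 1)) ∧
      (Odd n → X ^ 2 * genHermite n = X * realHermite (n + 1) + realHermite n) := by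
  induction n with
  | zero => simp [genHermite, realHermite]
  | succ n ih =>
    have hT := X_mul_dunkl (genHermite n)
    rw [genHermite_comp_neg] at hT
    have hH := realHermite_succ (n + 1)
    constructor
    · intro hn
      have ho : Odd n := by rw [Nat.even_add_one] at hn; exact Nat.not_even_iff_odd.1 hn
      have h1 := ih.2 ho
      have h2 := congrArg derivative h1
      rw [derivative_mul, derivative_X_pow, derivative_add, derivative_mul, derivative_X] at h2
      rw [ho.neg_one_pow] at hT
      have h0 := realHermite_succ n
      refine mul_left_cancel₀ X_ne_zero ?_
      rw [genHermite, hH]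
      simp only [C_neg, C_1, Nat.cast_ofNat, Nat.add_one_sub_one, pow_one,
        show C (2 : ℝ) = 2 by rfl] at h2 hT
      linear_combination X * h1 - h2 - X * hT - h0
    · intro hn
      have he : Even n := by rw [Nat.odd_add_one] at hn; exact Nat.not_odd_iff_even.1 hn
      have h1 := ih.1 he
      have h2 := congrArg derivative h1
      rw [derivative_mul, derivative_X] at h2
      rw [he.neg_one_pow, C_1] at hT
      rw [genHermite, hH]
      linear_combination (X ^ 2 + 1) * h1 - X * h2 - X * hT

theorem eval_zero_realHermite_even (m : ℕ) :
    (realHermite (2 * m)).eval 0 = (-1) ^ m * ((2 * m - 1).doubleFactorial : ℝ) := by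
  have h := coeff_hermite_explicit m 0
  rw [realHermite, eval_map, eval₂_at_zero, ← add_zero (2 * m), h]
  simp

theorem eval_zero_realHermite_odd {k : ℕ} (hk : Odd k) : (realHermite k).eval 0 = 0 := by
  rw [realHermite, eval_map, eval₂_at_zero, coeff_hermite_of_odd_add (by simpa using hk)]
  simp

theorem eval_zero_derivative_realHermite_odd (m : ℕ) :
    (derivative (realHermite (2 * m + 1))).eval 0 =
      (2 * m + 1) * ((-1) ^ m * ((2 * m - 1).doubleFactorial : ℝ)) := by
  rw [derivative_realHermite_succ, eval_mul, eval_C, eval_zero_realHermite_even]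
  push_cast; ring

theorem eval_zero_derivative_realHermite_even {k : ℕ} (hk : Even k) :
    (derivative (realHermite k)).eval 0 = 0 := by
  rcases k with _ | k
  · simp [realHermite]
  · rw [derivative_realHermite_succ, eval_mul,
      eval_zero_realHermite_odd (by rw [Nat.even_add_one] at hk; exact Nat.not_even_iff_odd.1 hk),
      mul_zero]

end Hermite

/-! ### Values at the origin and the Wallis product -/

section Amplitude

theorem normSq_two_mul (m : ℕ) : normSq (2 * m) = ((2 * m + 1).factorial : ℝ) := by
  induction m with
  | zero => simp [normSq]
  | succ m ih =>
    rw [show 2 * (m + 1) = 2 * m + 1 + 1 by ring, normSq_succ, normSq_succ, ih,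
      beta_add_one_of_even (even_two_mul m), beta, if_pos (by simp [Nat.even_add_one]),
      Nat.factorial_succ (2 * m + 1 + 1), Nat.factorial_succ (2 * m + 1)]
    push_cast; ring

theorem normSq_two_mul_add_one (m : ℕ) :
    normSq (2 * m + 1) = (2 * m + 3) * ((2 * m + 1).factorial : ℝ) := by
  rw [normSq_succ, normSq_two_mul, beta_add_one_of_even (even_two_mul m)]
  push_cast; ring

/-- Combines the factorial form of the Wallis product with `(2m)! = 2^m m! (2m-1)‼`. At `m = 0`
truncation gives `0‼ = 1`. -/
theorem doubleFactorial_pow_four_mul_wallis (m : ℕ) :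
    ((2 * m - 1).doubleFactorial : ℝ) ^ 4 * ((2 * m + 1) * Real.Wallis.W m) =
      ((2 * m).factorial : ℝ) ^ 2 := by
  have h1 : (((2 * m).factorial : ℕ) : ℝ) =
      (2 ^ m * m.factorial : ℝ) * ((2 * m - 1).doubleFactorial : ℝ) := by
    rcases m with _ | m
    · simp
    · rw [show 2 * (m + 1) = 2 * m + 1 + 1 by ring, Nat.factorial_eq_mul_doubleFactorial,
        show 2 * m + 1 + 1 = 2 * (m + 1) by ring, Nat.doubleFactorial_two_mul]
      push_cast
      rw [show 2 * (m + 1) - 1 = 2 * m + 1 by omega]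
  have h0 : ((2 * m).factorial : ℝ) ≠ 0 := by positivity
  have hw := Real.Wallis.W_eq_factorial_ratio m
  rw [hw]
  field_simp
  rw [h1]
  rw [show (2 : ℝ) ^ (4 * m) = (2 ^ m) ^ 4 by rw [← pow_mul, mul_comm]]
  ring

/-- Bounds for the reciprocal of the Wallis product. -/
theorem wallis_inv_bounds (m : ℕ) : 2 / Real.pi ≤ (Real.Wallis.W m)⁻¹ ∧
    (Real.Wallis.W m)⁻¹ ≤ 2 / Real.pi * ((2 * m + 2) / (2 * m + 1)) := by
  have hW := Real.Wallis.W_pos m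
  have hpi := Real.pi_pos
  constructor
  · rw [← inv_div, inv_le_inv₀ (by positivity) hW]
    exact Real.Wallis.W_le m
  · have := inv_anti₀ (by positivity) (Real.Wallis.le_W m)
    refine this.trans_eq ?_
    field_simp

theorem abs_sub_sqrt_le {x b δ : ℝ} (hx : 0 ≤ x) (hb : 0 < b) (h : |x ^ 2 - b| ≤ δ) :
    |x - Real.sqrt b| ≤ δ / Real.sqrt b := by
  have hs := Real.sqrt_pos.2 hb
  rw [le_div_iff₀ hs]
  have h1 : x ^ 2 - b = (x - Real.sqrt b) * (x + Real.sqrt b) := by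
    linear_combination Real.sq_sqrt hb.le
  rw [h1, abs_mul, abs_of_nonneg (a := x + Real.sqrt b) (by positivity)] at h
  nlinarith [abs_nonneg (x - Real.sqrt b)]

/-- Used with `x = n = 2m`, `b = 2/π` and `V = 1 / W m`; the product is then `(R² / normSq n)²`. -/
theorem abs_wallis_factor_even_le {x b V : ℝ} (hx : 1 ≤ x) (hb0 : 0 < b) (hb1 : b ≤ 1)
    (h1 : b ≤ V) (h2 : V ≤ b * ((x + 2) / (x + 1))) :
    |(x + 1) / (x + 3 / 2) * V - b| ≤ 2 / x := by
  have h3 : 0 < 2 / x := by positivity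
  rw [abs_le]
  constructor
  · have h4 : (x + 1) / (x + 3 / 2) * b ≤ (x + 1) / (x + 3 / 2) * V := by gcongr
    have h5 : 1 - 2 / x ≤ (x + 1) / (x + 3 / 2) := by
      rw [sub_le_iff_le_add, div_add_div _ _ (by positivity) (by positivity),
        le_div_iff₀ (by positivity)]
      nlinarith
    nlinarith
  · have h4 : (x + 1) / (x + 3 / 2) * V ≤ (x + 1) / (x + 3 / 2) * (b * ((x + 2) / (x + 1))) := by
      gcongr
    have h5 : (x + 1) / (x + 3 / 2) * (b * ((x + 2) / (x + 1))) =
        b * ((x + 2) / (x + 3 / 2)) := by field_simp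
    have h6 : (x + 2) / (x + 3 / 2) ≤ 1 + 2 / x := by
      rw [← sub_le_iff_le_add', div_sub_one (by positivity), div_le_div_iff₀ (by positivity)
        (by positivity)]
      nlinarith
    nlinarith

/-- The analogue for `x = n = 2m + 1` and `V = 1 / W (m + 1)`. The rational factor is about `1 -
5/(2x)`, so the error `2/x` requires more than `b ≤ 1`; the bound `2/3` comes from `π > 3`. -/
theorem abs_wallis_factor_odd_le {x b V : ℝ} (hx : 1 ≤ x) (hb0 : 0 < b) (hb1 : b ≤ 2 / 3)
    (h1 : b ≤ V) (h2 : V ≤ b * ((x + 3) / (x + 2))) :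
    |(x + 3 / 2) * (x + 1) ^ 2 / (x + 2) ^ 3 * V - b| ≤ 2 / x := by
  have h3 : 0 < 2 / x := by positivity
  rw [abs_le]
  constructor
  · have h4 : (x + 3 / 2) * (x + 1) ^ 2 / (x + 2) ^ 3 * b ≤
        (x + 3 / 2) * (x + 1) ^ 2 / (x + 2) ^ 3 * V := by gcongr
    have h5 : (x + 3 / 2) * (x + 1) ^ 2 / (x + 2) ^ 3 =
        1 - 5 / 2 / (x + 2) + (2 * x + 7 / 2) / (x + 2) ^ 3 := by
      field_simp; ring
    have h6 : 0 < (2 * x + 7 / 2) / (x + 2) ^ 3 := by positivity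
    have h7 : 5 / 2 / (x + 2) * b ≤ 2 / x := by
      have h8 : 5 / 2 / (x + 2) * b ≤ 5 / 2 / (x + 2) * (2 / 3) := by gcongr
      refine h8.trans ?_
      rw [div_mul_eq_mul_div, div_le_div_iff₀ (by positivity) (by positivity)]
      nlinarith
    have h9 := mul_pos h6 hb0
    rw [h5] at h4 ⊢
    linarith
  · have h4 : (x + 3 / 2) * (x + 1) ^ 2 / (x + 2) ^ 3 * V ≤
        (x + 3 / 2) * (x + 1) ^ 2 / (x + 2) ^ 3 * (b * ((x + 3) / (x + 2))) := by gcongr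
    have h5 : (x + 3 / 2) * (x + 1) ^ 2 / (x + 2) ^ 3 * ((x + 3) / (x + 2)) ≤ 1 := by
      rw [div_mul_div_comm, div_le_one (by positivity)]
      nlinarith [sq_nonneg x, mul_nonneg (by linarith : 0 ≤ x) (sq_nonneg x)]
    have h6 := mul_le_mul_of_nonneg_left h5 hb0.le
    linarith

/-- The initial data of the Hermite function in amplitude-phase form; `c` is `(n + 3/2)^{-1/4}`. -/
theorem exists_amplitude (n : ℕ) (hn : 1 ≤ n) (c : ℝ) (hc : 0 < c)
    (hc4 : c ^ 4 * ((n : ℝ) + 3 / 2) = 1) :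
    ∃ R : ℝ, 0 < R ∧
      (realHermite (n + 1)).eval 0 / c = R * Real.cos (Real.pi * ((n : ℝ) + 1) / 2) ∧
      c * (Polynomial.derivative (realHermite (n + 1))).eval 0 =
        R * Real.sin (Real.pi * ((n : ℝ) + 1) / 2) ∧
      |R ^ 2 / normSq n - Real.sqrt (2 / Real.pi)| ≤ 4 / (n : ℝ) := by
  have hpi := Real.pi_pos
  have hn0 : (1 : ℝ) ≤ n := by exact_mod_cast hn
  have hpi1 : 1 / 2 ≤ 2 / Real.pi := by
    rw [div_le_div_iff₀ (by norm_num) hpi]; linarith [Real.pi_le_four]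
  have hpi2 : 2 / Real.pi ≤ 1 := by
    rw [div_le_one hpi]; exact Real.two_le_pi
  have hs : 1 / 2 ≤ Real.sqrt (2 / Real.pi) :=
    (Real.le_sqrt (by norm_num) (by positivity)).2 (by linarith)
  -- Wallis controls the square of `R² / normSq n`. Taking the root divides the error by `√(2/π) ≥
  -- 1/2`, which doubles the constant.
  have hred : ∀ R : ℝ, |(R ^ 2 / normSq n) ^ 2 - 2 / Real.pi| ≤ 2 / (n : ℝ) →
      |R ^ 2 / normSq n - Real.sqrt (2 / Real.pi)| ≤ 4 / (n : ℝ) := by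
    intro R hR
    refine (abs_sub_sqrt_le (div_nonneg (sq_nonneg R) (normSq_pos n).le)
      (by positivity) hR).trans ?_
    rw [div_le_iff₀ (by linarith)]
    have : 0 < 4 / (n : ℝ) := by positivity
    calc 2 / (n : ℝ) = 4 / n * (1 / 2) := by ring
      _ ≤ _ := by gcongr
  have hcK : c ^ 4 = 1 / ((n : ℝ) + 3 / 2) := by
    rw [eq_div_iff (by positivity)]; exact hc4
  rcases Nat.even_or_odd' n with ⟨m, rfl | rfl⟩
  · have hd : (0 : ℝ) < ((2 * m - 1).doubleFactorial : ℝ) := by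
      exact_mod_cast Nat.doubleFactorial_pos _
    have hang : Real.pi * (((2 * m : ℕ) : ℝ) + 1) / 2 = Real.pi / 2 + m * Real.pi := by
      push_cast; ring
    -- For even `n` the polynomial `He_{n+1}` is odd: its value at `0` vanishes and `R` is read off
    -- the derivative. For odd `n` the roles are exchanged.
    refine ⟨c * ((2 * m + 1) * ((2 * m - 1).doubleFactorial : ℝ)), by positivity, ?_, ?_,
      hred _ ?_⟩
    · rw [eval_zero_realHermite_odd (by simp), hang, Real.cos_add_nat_mul_pi, Real.cos_pi_div_two]
      simp
    · rw [eval_zero_derivative_realHermite_odd, hang, Real.sin_add_nat_mul_pi, Real.sin_pi_div_two]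
      ring
    · obtain ⟨hW1, hW2⟩ := wallis_inv_bounds m
      have hWp := Real.Wallis.W_pos m
      have hT : ((c * ((2 * m + 1) * ((2 * m - 1).doubleFactorial : ℝ))) ^ 2 /
          normSq (2 * m)) ^ 2 = (2 * m + 1) / (2 * m + 3 / 2) * (Real.Wallis.W m)⁻¹ := by
        have hdW := doubleFactorial_pow_four_mul_wallis m
        have hf : (0 : ℝ) < ((2 * m).factorial : ℝ) := by positivity
        have h4 : ((2 * m - 1).doubleFactorial : ℝ) ^ 4 =
            ((2 * m).factorial : ℝ) ^ 2 / ((2 * m + 1) * Real.Wallis.W m) := by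
          rw [eq_div_iff (by positivity), hdW]
        rw [normSq_two_mul, Nat.factorial_succ]
        push_cast at hcK ⊢
        rw [div_pow, mul_pow c, mul_pow _ ((2 * m - 1).doubleFactorial : ℝ),
          mul_pow (c ^ 2), mul_pow _ (((2 * m - 1).doubleFactorial : ℝ) ^ 2), ← pow_mul, ← pow_mul,
          ← pow_mul, h4, hcK]
        field_simp
      rw [hT]
      push_cast at hn0 ⊢
      exact abs_wallis_factor_even_le hn0 (by positivity) hpi2 hW1 hW2
  · have hd : (0 : ℝ) < ((2 * (m + 1) - 1).doubleFactorial : ℝ) := by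
      exact_mod_cast Nat.doubleFactorial_pos _
    have hang : Real.pi * (((2 * m + 1 : ℕ) : ℝ) + 1) / 2 = 0 + (m + 1 : ℕ) * Real.pi := by
      push_cast; ring
    have hk : 2 * m + 1 + 1 = 2 * (m + 1) := by ring
    refine ⟨((2 * (m + 1) - 1).doubleFactorial : ℝ) / c, by positivity, ?_, ?_, hred _ ?_⟩
    · rw [hk, eval_zero_realHermite_even, hang, Real.cos_add_nat_mul_pi, Real.cos_zero]
      ring
    · rw [hk, eval_zero_derivative_realHermite_even (even_two_mul _), hang,
        Real.sin_add_nat_mul_pi, Real.sin_zero]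
      simp
    · obtain ⟨hW1, hW2⟩ := wallis_inv_bounds (m + 1)
      have hWp := Real.Wallis.W_pos (m + 1)
      have hT : ((((2 * (m + 1) - 1).doubleFactorial : ℝ) / c) ^ 2 /
          normSq (2 * m + 1)) ^ 2 = (2 * m + 5 / 2) * (2 * m + 2) ^ 2 / (2 * m + 3) ^ 3 *
            (Real.Wallis.W (m + 1))⁻¹ := by
        have hdW := doubleFactorial_pow_four_mul_wallis (m + 1)
        have hf : (0 : ℝ) < ((2 * m + 1).factorial : ℝ) := by positivity
        have h4 : ((2 * (m + 1) - 1).doubleFactorial : ℝ) ^ 4 =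
            ((2 * (m + 1)).factorial : ℝ) ^ 2 /
              ((2 * ((m + 1 : ℕ) : ℝ) + 1) * Real.Wallis.W (m + 1)) := by
          rw [eq_div_iff (by positivity), hdW]
        rw [normSq_two_mul_add_one]
        rw [← hk, Nat.factorial_succ] at h4
        rw [← hk]
        push_cast at hcK h4 ⊢
        rw [div_pow, div_pow, div_pow, ← pow_mul, ← pow_mul, h4, hcK]
        field_simp
        ring
      rw [hT]
      push_cast at hn0 hW2 ⊢
      have hpi3 : 2 / Real.pi ≤ 2 / 3 := by
        have := Real.pi_gt_three
        gcongr
      convert abs_wallis_factor_odd_le hn0 (by positivity) hpi3 hW1 ?_ using 4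
      · ring
      · refine hW2.trans_eq ?_
        ring_nf

end Amplitude

/-! ### Liouville–Green approximation with error bound -/

section LiouvilleGreen

open Set

/-- The Liouville–Green amplitude `(K - x²/4)^{-1/4}`. -/
noncomputable def lgAmp (K x : ℝ) : ℝ := (K - x ^ 2 / 4) ^ (-(1 / 4) : ℝ)

/-- The Liouville–Green phase, a primitive of `√(K - x²/4)`. -/
noncomputable def lgPhase (K x : ℝ) : ℝ :=
  K * Real.arcsin (x / (2 * Real.sqrt K)) + x / 2 * Real.sqrt (K - x ^ 2 / 4)

theorem lgAmp_pos {K x : ℝ} (h : 0 < K - x ^ 2 / 4) : 0 < lgAmp K x := Real.rpow_pos_of_pos h _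

theorem lgAmp_pow_four {K x : ℝ} (h : 0 < K - x ^ 2 / 4) :
    lgAmp K x ^ 4 * (K - x ^ 2 / 4) = 1 := by
  rw [lgAmp, ← Real.rpow_natCast, ← Real.rpow_mul h.le]
  norm_num
  rw [Real.rpow_neg_one, inv_mul_cancel₀ h.ne']

theorem inv_lgAmp_pow_four {K x : ℝ} (h : 0 < K - x ^ 2 / 4) :
    (lgAmp K x ^ 4)⁻¹ = K - x ^ 2 / 4 := inv_eq_of_mul_eq_one_right (lgAmp_pow_four h)

theorem sqrt_eq_lgAmp {K x : ℝ} (h : 0 < K - x ^ 2 / 4) :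
    Real.sqrt (K - x ^ 2 / 4) = (lgAmp K x ^ 2)⁻¹ := by
  have h2 := lgAmp_pos h
  rw [Real.sqrt_eq_iff_mul_self_eq h.le (by positivity), ← mul_inv, ← inv_lgAmp_pow_four h]
  ring

theorem hasDerivAt_lgAmp {K x : ℝ} (h : 0 < K - x ^ 2 / 4) :
    HasDerivAt (lgAmp K) (x / 8 * lgAmp K x ^ 5) x := by
  have h1 : HasDerivAt (fun x : ℝ => K - x ^ 2 / 4) (-(x / 2)) x := by
    have := ((hasDerivAt_id x).pow 2).div_const 4 |>.const_sub K
    refine this.congr_deriv ?_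
    simp; ring
  have h2 := h1.rpow_const (p := (-(1 / 4) : ℝ)) (Or.inl h.ne')
  refine h2.congr_deriv ?_
  have h3 : (K - x ^ 2 / 4) ^ (-(1 / 4) - 1 : ℝ) = lgAmp K x ^ 5 := by
    rw [lgAmp, ← Real.rpow_mul_natCast h.le]
    norm_num
  rw [h3]; ring

theorem hasDerivAt_lgPhase {K x : ℝ} (h : 0 < K - x ^ 2 / 4) :
    HasDerivAt (lgPhase K) ((lgAmp K x ^ 2)⁻¹) x := by
  have hK : 0 < K := by nlinarith [sq_nonneg x]
  have hsK := Real.sqrt_pos.2 hK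
  have hsq := Real.sq_sqrt hK.le
  have hp : 0 < Real.sqrt (K - x ^ 2 / 4) := Real.sqrt_pos.2 h
  have hpq := Real.sq_sqrt h.le
  have hlt : (x / (2 * Real.sqrt K)) ^ 2 < 1 := by
    rw [div_pow, mul_pow, hsq, div_lt_one (by positivity)]; linarith
  have habs := (sq_lt_one_iff_abs_lt_one _).1 hlt
  rw [abs_lt] at habs
  have h1 : HasDerivAt (fun x : ℝ => K - x ^ 2 / 4) (-(x / 2)) x := by
    have := ((hasDerivAt_id x).pow 2).div_const 4 |>.const_sub K
    refine this.congr_deriv ?_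
    simp; ring
  have h2 := h1.sqrt h.ne'
  have h3 := ((Real.hasDerivAt_arcsin habs.1.ne' habs.2.ne).comp x
    ((hasDerivAt_id x).div_const (2 * Real.sqrt K))).const_mul K
  have h4 := h3.add (((hasDerivAt_id x).div_const 2).mul h2)
  refine h4.congr_deriv ?_
  have h5 : Real.sqrt (1 - (x / (2 * Real.sqrt K)) ^ 2) =
      Real.sqrt (K - x ^ 2 / 4) / Real.sqrt K := by
    rw [← Real.sqrt_div h.le, div_pow, mul_pow, hsq]
    congr 1; field_simp; ring
  simp only [id]
  rw [h5, ← sqrt_eq_lgAmp h]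
  generalize Real.sqrt (K - x ^ 2 / 4) = p at hp hpq
  field_simp
  linear_combination (-4 : ℝ) * hpq

/-- The slowly varying complex amplitude of a solution `w` of `w'' = (x²/4 - K) w`. -/
noncomputable def lgCoeff (K : ℝ) (w w' : ℝ → ℝ) (x : ℝ) : ℂ :=
  (((w x / lgAmp K x : ℝ) : ℂ) +
    ((lgAmp K x * w' x - x / 8 * lgAmp K x ^ 5 * w x : ℝ) : ℂ) * Complex.I) *
    Complex.exp (((lgPhase K x : ℝ) : ℂ) * Complex.I)

/-- With `f` the amplitude, `X = w/f` and `Y = f w' - f' w` satisfy `X' = Y/f²` and `Y' = -X/f² - f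
f'' X`. The phase has derivative `1/f²`, so its exponential removes the rotation and only the term
`f f'' X` survives, with `f f'' = f⁶/8 + 5x² f¹⁰/64`. -/
theorem hasDerivAt_lgCoeff {K x : ℝ} {w w' : ℝ → ℝ} (h : 0 < K - x ^ 2 / 4)
    (hw : HasDerivAt w (w' x) x) (hw' : HasDerivAt w' ((x ^ 2 / 4 - K) * w x) x) :
    HasDerivAt (lgCoeff K w w') (-(((lgAmp K x ^ 6 / 8 + 5 * x ^ 2 / 64 * lgAmp K x ^ 10) *
      (w x / lgAmp K x) : ℝ) : ℂ) * Complex.I *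
      Complex.exp (((lgPhase K x : ℝ) : ℂ) * Complex.I)) x := by
  have hf := lgAmp_pos h
  have hf4 := lgAmp_pow_four h
  have hdf := hasDerivAt_lgAmp h
  have hX := (hw.div hdf hf.ne').ofReal_comp
  have hY := ((hdf.mul hw').sub (((((hasDerivAt_id x).div_const 8).mul (hdf.pow 5))).mul
    hw)).ofReal_comp
  have hE := (((hasDerivAt_lgPhase h).ofReal_comp).mul_const Complex.I).cexp
  have hG := (hX.add (hY.mul_const Complex.I)).mul hE
  refine hG.congr_deriv ?_
  set f := lgAmp K x with hfdef
  have hy : x ^ 2 / 4 - K = -(f ^ 4)⁻¹ := by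
    rw [eq_neg_iff_add_eq_zero]
    have : (f ^ 4)⁻¹ = K - x ^ 2 / 4 := inv_lgAmp_pow_four h
    rw [this]; ring
  have hfc : (f : ℂ) ≠ 0 := by exact_mod_cast hf.ne'
  simp only [Pi.mul_apply, Pi.add_apply, Pi.sub_apply, Pi.div_apply, Pi.pow_apply, id, hy]
  push_cast
  have hI := Complex.I_sq
  rw [← hfdef]
  field_simp
  ring_nf
  simp only [hI]
  ring

theorem lgAmp_le {K x s : ℝ} (hx : 0 ≤ x) (hxs : x ≤ s) (h : 0 < K - s ^ 2 / 4) :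
    lgAmp K x ≤ lgAmp K s := by
  refine Real.rpow_le_rpow_of_nonpos h ?_ (by norm_num)
  nlinarith

/-- The rate of change of the Liouville–Green coefficients. -/
noncomputable def lgRate (K s : ℝ) : ℝ := lgAmp K s ^ 6 / 8 + 5 * s ^ 2 / 64 * lgAmp K s ^ 10

theorem abs_le_norm_ofReal_add_mul_I (a b : ℝ) : |a| ≤ ‖(a : ℂ) + (b : ℂ) * Complex.I‖ :=
  le_trans (le_of_eq (by simp)) (Complex.abs_re_le_norm _)

theorem abs_le_norm_ofReal_add_mul_I_im (a b : ℝ) : |b| ≤ ‖(a : ℂ) + (b : ℂ) * Complex.I‖ :=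
  le_trans (le_of_eq (by simp)) (Complex.abs_im_le_norm _)

theorem abs_div_lgAmp_le_norm_lgCoeff (K : ℝ) (w w' : ℝ → ℝ) (x : ℝ) : |w x / lgAmp K x| ≤ ‖lgCoeff K w w' x‖ := by
  rw [lgCoeff, norm_mul, Complex.norm_exp_ofReal_mul_I, mul_one]
  exact abs_le_norm_ofReal_add_mul_I _ _

/-- The Liouville–Green estimate: the coefficients of a solution stay close to their initial
values. -/
theorem norm_lgCoeff_sub_le {K s : ℝ} {w w' : ℝ → ℝ} (hs : 0 ≤ s) (h : 0 < K - s ^ 2 / 4)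
    (hw : ∀ x, HasDerivAt w (w' x) x) (hw' : ∀ x, HasDerivAt w' ((x ^ 2 / 4 - K) * w x) x) :
    ‖lgCoeff K w w' s - lgCoeff K w w' 0‖ ≤
      ‖lgCoeff K w w' 0‖ * (lgRate K s * s * Real.exp (lgRate K s * s)) := by
  have hy : ∀ x ∈ Icc 0 s, 0 < K - x ^ 2 / 4 := by
    intro x hx
    nlinarith [hx.1, hx.2]
  have hder := fun x (hx : x ∈ Icc 0 s) => hasDerivAt_lgCoeff (hy x hx) (hw x) (hw' x)
  have hrate : 0 ≤ lgRate K s := by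
    have := (lgAmp_pos h).le
    unfold lgRate; positivity
  have hbound : ∀ x ∈ Icc 0 s, ‖(-(((lgAmp K x ^ 6 / 8 + 5 * x ^ 2 / 64 * lgAmp K x ^ 10) *
      (w x / lgAmp K x) : ℝ) : ℂ) * Complex.I *
      Complex.exp (((lgPhase K x : ℝ) : ℂ) * Complex.I))‖ ≤
        lgRate K s * ‖lgCoeff K w w' x‖ := by
    intro x hx
    rw [norm_mul, norm_mul, Complex.norm_I, Complex.norm_exp_ofReal_mul_I, mul_one, mul_one,
      norm_neg, Complex.norm_real, Real.norm_eq_abs, abs_mul]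
    have hf := lgAmp_pos (hy x hx)
    have hfs := lgAmp_le hx.1 hx.2 h
    have h0 := hx.1
    have h1 := hx.2
    have hr : lgAmp K x ^ 6 / 8 + 5 * x ^ 2 / 64 * lgAmp K x ^ 10 ≤ lgRate K s := by
      unfold lgRate; gcongr
    rw [abs_of_nonneg (a := lgAmp K x ^ 6 / 8 + 5 * x ^ 2 / 64 * lgAmp K x ^ 10) (by positivity)]
    exact mul_le_mul hr (abs_div_lgAmp_le_norm_lgCoeff K w w' x) (abs_nonneg _) hrate
  have hcont : ContinuousOn (lgCoeff K w w') (Icc 0 s) := fun x hx =>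
    (hder x hx).continuousAt.continuousWithinAt
  -- Gronwall bounds the size of the coefficient; the mean value inequality below then bounds its
  -- displacement.
  have hgron : ∀ x ∈ Icc 0 s, ‖lgCoeff K w w' x‖ ≤
      ‖lgCoeff K w w' 0‖ * Real.exp (lgRate K s * s) := by
    intro x hx
    have h1 := norm_le_gronwallBound_of_norm_deriv_right_le (ε := 0) hcont
      (fun x hx => (hder x (Ico_subset_Icc_self hx)).hasDerivWithinAt) le_rfl
      (fun x hx => by simpa using hbound x (Ico_subset_Icc_self hx)) x hx
    rw [gronwallBound_ε0, sub_zero] at h1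
    refine h1.trans ?_
    have := hx.2
    gcongr
  have h2 := norm_image_sub_le_of_norm_deriv_le_segment' (C := lgRate K s *
      (‖lgCoeff K w w' 0‖ * Real.exp (lgRate K s * s)))
    (fun x hx => (hder x hx).hasDerivWithinAt)
    (fun x hx => (hbound x (Ico_subset_Icc_self hx)).trans
      (mul_le_mul_of_nonneg_left (hgron x (Ico_subset_Icc_self hx)) hrate)) s
    (right_mem_Icc.2 hs)
  refine h2.trans_eq ?_
  ring

/-- Amplitude-phase form of the Liouville–Green estimate. -/
theorem lg_approx {K s R α δ : ℝ} {w w' : ℝ → ℝ} (hs : 0 ≤ s) (h : 0 < K - s ^ 2 / 4)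
    (hw : ∀ x, HasDerivAt w (w' x) x) (hw' : ∀ x, HasDerivAt w' ((x ^ 2 / 4 - K) * w x) x)
    (hR : 0 < R) (h0 : w 0 / lgAmp K 0 = R * Real.cos α) (h1 : lgAmp K 0 * w' 0 = R * Real.sin α)
    (hδ : lgRate K s * s * Real.exp (lgRate K s * s) ≤ δ) :
    |w s / lgAmp K s / R - Real.cos (lgPhase K s - α)| ≤ δ ∧
      |(lgAmp K s * w' s - s / 8 * lgAmp K s ^ 5 * w s) / R + Real.sin (lgPhase K s - α)| ≤ δ := by
  have hG0 : lgCoeff K w w' 0 = R * Complex.exp ((α : ℂ) * Complex.I) := by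
    rw [lgCoeff, h0, h1, Complex.exp_mul_I α]
    simp [lgPhase]
    ring
  have hn := norm_lgCoeff_sub_le hs h hw hw'
  have hn0 : ‖lgCoeff K w w' 0‖ = R := by
    rw [hG0, norm_mul, Complex.norm_exp_ofReal_mul_I, mul_one, Complex.norm_real,
      Real.norm_of_nonneg hR.le]
  rw [hn0] at hn
  have hRc : (R : ℂ) ≠ 0 := by exact_mod_cast hR.ne'
  -- Rotating back by the phase at `s` makes the two claimed errors the real and imaginary parts of
  -- one small complex number.
  have key : ((w s / lgAmp K s / R - Real.cos (lgPhase K s - α) : ℝ) : ℂ) +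
      (((lgAmp K s * w' s - s / 8 * lgAmp K s ^ 5 * w s) / R + Real.sin (lgPhase K s - α) : ℝ) : ℂ)
        * Complex.I = (lgCoeff K w w' s - lgCoeff K w w' 0) / R *
          Complex.exp (((-lgPhase K s : ℝ) : ℂ) * Complex.I) := by
    have e1 : Complex.exp (((lgPhase K s : ℝ) : ℂ) * Complex.I) *
        Complex.exp (((-lgPhase K s : ℝ) : ℂ) * Complex.I) = 1 := by
      rw [← Complex.exp_add]; push_cast
      rw [← add_mul, add_neg_cancel, zero_mul, Complex.exp_zero]
    have e2 : Complex.exp ((α : ℂ) * Complex.I) *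
        Complex.exp (((-lgPhase K s : ℝ) : ℂ) * Complex.I) =
          Complex.cos (lgPhase K s - α) - Complex.sin (lgPhase K s - α) * Complex.I := by
      rw [← Complex.exp_add, show (α : ℂ) * Complex.I + ((-lgPhase K s : ℝ) : ℂ) * Complex.I =
        (-((lgPhase K s : ℂ) - α)) * Complex.I by push_cast; ring, Complex.exp_mul_I,
        Complex.cos_neg, Complex.sin_neg]
      ring
    have e3 : ∀ Z E A E' : ℂ, (Z * E - R * A) / R * E' = Z / R * (E * E') - A * E' := by
      intro Z E A E'; field_simp
    rw [hG0, lgCoeff, e3, e1, e2]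
    push_cast
    ring
  have hnorm : ‖(lgCoeff K w w' s - lgCoeff K w w' 0) / R *
      Complex.exp (((-lgPhase K s : ℝ) : ℂ) * Complex.I)‖ ≤ δ := by
    rw [norm_mul, Complex.norm_exp_ofReal_mul_I, mul_one, norm_div, Complex.norm_real,
      Real.norm_of_nonneg hR.le, div_le_iff₀ hR, mul_comm]
    exact hn.trans (by gcongr)
  rw [← key] at hnorm
  exact ⟨(abs_le_norm_ofReal_add_mul_I _ _).trans hnorm,
    (abs_le_norm_ofReal_add_mul_I_im _ _).trans hnorm⟩

end LiouvilleGreen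

/-! ### Hermite functions and their ladder relations -/

section HermiteFunction

open Polynomial

/-- The Hermite function `He_k(x) e^{-x²/4}`. -/
noncomputable def hermiteFun (k : ℕ) (x : ℝ) : ℝ := (realHermite k).eval x * Real.exp (-x ^ 2 / 4)

/-- The derivative of the Hermite function. -/
noncomputable def hermiteFunDeriv (k : ℕ) (x : ℝ) : ℝ :=
  ((derivative (realHermite k)).eval x - x / 2 * (realHermite k).eval x) * Real.exp (-x ^ 2 / 4)

theorem hasDerivAt_exp_neg_sq_div_four (x : ℝ) :
    HasDerivAt (fun x : ℝ => Real.exp (-x ^ 2 / 4)) (-(x / 2) * Real.exp (-x ^ 2 / 4)) x := by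
  have h1 : HasDerivAt (fun x : ℝ => -x ^ 2 / 4) (-(x / 2)) x := by
    refine (((hasDerivAt_id x).pow 2).neg.div_const 4).congr_deriv ?_
    simp; ring
  exact h1.exp.congr_deriv (mul_comm _ _)

theorem hasDerivAt_hermiteFun (k : ℕ) (x : ℝ) :
    HasDerivAt (hermiteFun k) (hermiteFunDeriv k x) x := by
  refine (((realHermite k).hasDerivAt x).mul (hasDerivAt_exp_neg_sq_div_four x)).congr_deriv ?_
  rw [hermiteFunDeriv]; ring

theorem hasDerivAt_hermiteFunDeriv (k : ℕ) (x : ℝ) :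
    HasDerivAt (hermiteFunDeriv k) ((x ^ 2 / 4 - (k + 1 / 2)) * hermiteFun k x) x := by
  have h1 := ((derivative (realHermite k)).hasDerivAt x).sub
    (((hasDerivAt_id x).div_const 2).mul ((realHermite k).hasDerivAt x))
  refine (h1.mul (hasDerivAt_exp_neg_sq_div_four x)).congr_deriv ?_
  rw [derivative_derivative_realHermite, hermiteFun]
  simp only [eval_sub, eval_mul, eval_X, eval_C, Pi.sub_apply, Pi.mul_apply, id]
  ring

theorem hermiteFun_zero (k : ℕ) : hermiteFun k 0 = (realHermite k).eval 0 := by simp [hermiteFun]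

theorem hermiteFunDeriv_zero (k : ℕ) :
    hermiteFunDeriv k 0 = (derivative (realHermite k)).eval 0 := by simp [hermiteFunDeriv]

/-- This raising relation and the lowering relation `hermiteFun_pred` recover the neighbours of
index `n + 1` from that function and its derivative, so one Liouville–Green estimate, with a single
`K`, serves all three indices. -/
theorem hermiteFun_succ (k : ℕ) (x : ℝ) :
    hermiteFun (k + 1) x = x / 2 * hermiteFun k x - hermiteFunDeriv k x := by
  rw [hermiteFun, realHermite_succ, hermiteFun, hermiteFunDeriv, eval_sub, eval_mul, eval_X]; ring

theorem hermiteFun_pred (k : ℕ) (x : ℝ) :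
    ((k : ℝ) + 1) * hermiteFun k x =
      x / 2 * hermiteFun (k + 1) x + hermiteFunDeriv (k + 1) x := by
  rw [hermiteFunDeriv, derivative_realHermite_succ, hermiteFun, hermiteFun, eval_mul, eval_C]; ring

theorem mul_genHermite_of_even {n : ℕ} (hn : Even n) (x : ℝ) :
    (genHermite n).eval x * Real.exp (-x ^ 2 / 4) * x = hermiteFun (n + 1) x := by
  have h := congrArg (eval x) ((genHermite_eq_realHermite n).1 hn)
  rw [eval_mul, eval_X] at h
  rw [hermiteFun, ← h]; ring

theorem mul_genHermite_of_odd {n : ℕ} (hn : Odd n) {x : ℝ} (hx : x ≠ 0) :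
    (genHermite n).eval x * Real.exp (-x ^ 2 / 4) * x =
      hermiteFun (n + 1) x + hermiteFun n x / x := by
  have h := congrArg (eval x) ((genHermite_eq_realHermite n).2 hn)
  rw [eval_mul, eval_pow, eval_add, eval_mul, eval_X] at h
  rw [hermiteFun, hermiteFun]
  field_simp
  linear_combination h

end HermiteFunction

/-! ### Asymptotics of the generalized Hermite polynomials in the bulk -/

section Bulk

theorem bulk_eps_le_one {ε s : ℝ} {n : ℕ} (hn : 1 ≤ n)
    (hs : s ∈ Set.Icc (ε * Real.sqrt n) ((2 - ε) * Real.sqrt n)) : ε ≤ 1 := by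
  have h1 : 0 < Real.sqrt n := Real.sqrt_pos.2 (by exact_mod_cast hn)
  have h2 := hs.1.trans hs.2
  have h3 := le_of_mul_le_mul_right h2 h1
  linarith

/-- Elementary geometry of the bulk: `s = 2√K cos θ` with `cos θ` and `sin θ` bounded below. -/
theorem bulk_angle {ε s : ℝ} {n : ℕ} (hε : 0 < ε) (hn : 1 ≤ n)
    (hs : s ∈ Set.Icc (ε * Real.sqrt n) ((2 - ε) * Real.sqrt n)) :
    s = 2 * Real.sqrt ((n : ℝ) + 3 / 2) * Real.cos (angle n s) ∧
      ε / 4 ≤ Real.cos (angle n s) ∧ ε / 2 ≤ Real.sin (angle n s) ∧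
      (n : ℝ) + 3 / 2 - s ^ 2 / 4 =
        (Real.sqrt ((n : ℝ) + 3 / 2) * Real.sin (angle n s)) ^ 2 := by
  have hε1 := bulk_eps_le_one hn hs
  have hn1 : (1 : ℝ) ≤ n := by exact_mod_cast hn
  obtain ⟨h1, h2⟩ := hs
  set K : ℝ := (n : ℝ) + 3 / 2 with hK
  have hKp : 0 < K := by positivity
  set σ := Real.sqrt K with hσ
  have hσp : 0 < σ := Real.sqrt_pos.2 hKp
  have hσ2 : σ ^ 2 = K := Real.sq_sqrt hKp.le
  set τ := Real.sqrt n with hτ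
  have hτp : 0 < τ := Real.sqrt_pos.2 (by linarith)
  have hτ2 : τ ^ 2 = n := Real.sq_sqrt (by linarith)
  have hτσ : τ ≤ σ := Real.sqrt_le_sqrt (by linarith)
  -- This is `n + 3/2 ≤ 4n`. It turns `s ≥ ε √n` into the lower bound `ε/4` for the cosine.
  have hστ : σ ≤ 2 * τ := by
    refine abs_le_of_sq_le_sq' ?_ (by positivity) |>.2
    nlinarith
  have hs0 : 0 < s := lt_of_lt_of_le (by positivity) h1
  have hle : s / (2 * σ) ≤ 1 - ε / 2 := by
    rw [div_le_iff₀ (by positivity)]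
    nlinarith
  have hge : ε / 4 ≤ s / (2 * σ) := by
    rw [le_div_iff₀ (by positivity)]
    nlinarith
  have hcos : Real.cos (angle n s) = s / (2 * σ) := by
    rw [angle, ← hK, ← hσ]
    exact Real.cos_arccos (by linarith) (by linarith)
  have hs2 : s = 2 * σ * Real.cos (angle n s) := by
    rw [hcos]; field_simp
  have hsin0 : 0 ≤ Real.sin (angle n s) :=
    Real.sin_nonneg_of_nonneg_of_le_pi (Real.arccos_nonneg _) (Real.arccos_le_pi _)
  have hsc := Real.sin_sq_add_cos_sq (angle n s)
  refine ⟨hs2, hcos ▸ hge, ?_, ?_⟩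
  · refine abs_le_of_sq_le_sq' ?_ hsin0 |>.2
    rw [← hcos] at hle hge
    nlinarith
  · rw [← hσ2]
    have h3 : s ^ 2 = 4 * σ ^ 2 * Real.cos (angle n s) ^ 2 := by
      calc s ^ 2 = (2 * σ * Real.cos (angle n s)) ^ 2 := by rw [← hs2]
        _ = _ := by ring
    rw [h3]
    linear_combination (-σ ^ 2) * hsc

/-- Writing `arcsin` as `π/2 - arccos` leaves the constant `Kπ/2 - π(n+1)/2`, which equals `π/4` for
`K = n + 3/2`. -/
theorem lgPhase_bulk {ε s : ℝ} {n : ℕ} (hε : 0 < ε) (hn : 1 ≤ n)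
    (hs : s ∈ Set.Icc (ε * Real.sqrt n) ((2 - ε) * Real.sqrt n)) :
    lgPhase ((n : ℝ) + 3 / 2) s - Real.pi * ((n : ℝ) + 1) / 2 =
      ((n : ℝ) + 3 / 2) / 2 * ac (angle n s) + Real.pi / 4 := by
  obtain ⟨h1, h2, h3, h4⟩ := bulk_angle hε hn hs
  have hK : 0 < (n : ℝ) + 3 / 2 := by positivity
  have hsq := Real.sq_sqrt hK.le
  have harc : Real.arcsin (s / (2 * Real.sqrt ((n : ℝ) + 3 / 2))) = Real.pi / 2 - angle n s := by
    rw [angle, Real.arccos]; ring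
  rw [lgPhase, harc, h4, Real.sqrt_sq (mul_nonneg (Real.sqrt_nonneg _) (by linarith)), ac,
    Real.sin_two_mul]
  have h5 : s / 2 * (Real.sqrt ((n : ℝ) + 3 / 2) * Real.sin (angle n s)) =
      ((n : ℝ) + 3 / 2) * (Real.sin (angle n s) * Real.cos (angle n s)) := by
    calc _ = (2 * Real.sqrt ((n : ℝ) + 3 / 2) * Real.cos (angle n s)) / 2 *
          (Real.sqrt ((n : ℝ) + 3 / 2) * Real.sin (angle n s)) := by rw [← h1]
      _ = Real.sqrt ((n : ℝ) + 3 / 2) ^ 2 * (Real.sin (angle n s) * Real.cos (angle n s)) := by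
        ring
      _ = _ := by rw [hsq]
  rw [h5]
  ring

theorem lgAmp_sq_bulk {ε s : ℝ} {n : ℕ} (hε : 0 < ε) (hn : 1 ≤ n)
    (hs : s ∈ Set.Icc (ε * Real.sqrt n) ((2 - ε) * Real.sqrt n)) :
    0 < (n : ℝ) + 3 / 2 - s ^ 2 / 4 ∧
    lgAmp ((n : ℝ) + 3 / 2) s ^ 2 =
      (Real.sqrt ((n : ℝ) + 3 / 2) * Real.sin (angle n s))⁻¹ := by
  obtain ⟨h1, h2, h3, h4⟩ := bulk_angle hε hn hs
  have hσ : 0 < Real.sqrt ((n : ℝ) + 3 / 2) := Real.sqrt_pos.2 (by positivity)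
  have hsin : 0 < Real.sin (angle n s) := by linarith
  have hy : 0 < (n : ℝ) + 3 / 2 - s ^ 2 / 4 := by rw [h4]; positivity
  refine ⟨hy, ?_⟩
  have h5 := sqrt_eq_lgAmp hy
  rw [h4, Real.sqrt_sq (by positivity)] at h5
  rw [h5, inv_inv]

/-- Since `f²` is of order `1/σ` and `s ≤ 2σ`, the drift accumulated over `[0, s]` is of order
`σ⁻²`, that is `1/n`. -/
theorem lgRate_mul_le {σ ε s f : ℝ} (hσ : 0 < σ) (hε : 0 < ε) (hε1 : ε ≤ 1) (hs0 : 0 ≤ s)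
    (hs : s ≤ 2 * σ) (hf : f ^ 2 ≤ 2 / (σ * ε)) :
    (f ^ 6 / 8 + 5 * s ^ 2 / 64 * f ^ 10) * s ≤ 22 / (σ ^ 2 * ε ^ 5) := by
  have h1 : f ^ 6 ≤ (2 / (σ * ε)) ^ 3 := by
    rw [show f ^ 6 = (f ^ 2) ^ 3 by ring]; gcongr
  have h2 : f ^ 10 ≤ (2 / (σ * ε)) ^ 5 := by
    rw [show f ^ 10 = (f ^ 2) ^ 5 by ring]; gcongr
  have h3 : 0 ≤ f ^ 6 := by positivity
  have h4 : 0 ≤ f ^ 10 := by positivity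
  calc (f ^ 6 / 8 + 5 * s ^ 2 / 64 * f ^ 10) * s
      ≤ ((2 / (σ * ε)) ^ 3 / 8 + 5 * (2 * σ) ^ 2 / 64 * (2 / (σ * ε)) ^ 5) * (2 * σ) := by
        gcongr
    _ = (2 * ε ^ 2 + 20) / (σ ^ 2 * ε ^ 5) := by field_simp; ring
    _ ≤ 22 / (σ ^ 2 * ε ^ 5) := by
        gcongr
        nlinarith

theorem abs_mul_add_le {c d u v η x M δ : ℝ} (hc : |c| ≤ 1) (hd : |d| ≤ 1) (hu : |u| ≤ δ)
    (hv : |v| ≤ δ) (hx : |x| ≤ M) : |c * u - d * v + η * x| ≤ 2 * δ + |η| * M := by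
  have h1 : |c * u| ≤ 1 * δ := by rw [abs_mul]; exact mul_le_mul hc hu (abs_nonneg _) zero_le_one
  have h2 : |d * v| ≤ 1 * δ := by rw [abs_mul]; exact mul_le_mul hd hv (abs_nonneg _) zero_le_one
  have h3 : |η * x| ≤ |η| * M := by
    rw [abs_mul]; exact mul_le_mul_of_nonneg_left hx (abs_nonneg _)
  have h4 := abs_add_le (c * u - d * v) (η * x)
  have h5 := abs_sub (c * u) (d * v)
  linarith

/-- The Hermite function and its derivative in the bulk, in amplitude-phase form. -/
theorem exists_hermiteFun_asymptotics {ε : ℝ} (hε : 0 < ε) : ∃ E : ℝ, 0 < E ∧ ∀ n : ℕ, 1 ≤ n →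
    ∃ R : ℝ, 0 < R ∧ |R ^ 2 / normSq n - Real.sqrt (2 / Real.pi)| ≤ 4 / (n : ℝ) ∧
      ∀ s ∈ Set.Icc (ε * Real.sqrt n) ((2 - ε) * Real.sqrt n), ∃ x v : ℝ,
        hermiteFun (n + 1) s = x * (lgAmp ((n : ℝ) + 3 / 2) s * R) ∧
        hermiteFunDeriv (n + 1) s = (v / lgAmp ((n : ℝ) + 3 / 2) s ^ 2 +
          s / 8 * lgAmp ((n : ℝ) + 3 / 2) s ^ 4 * x) * (lgAmp ((n : ℝ) + 3 / 2) s * R) ∧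
        |x - Real.cos (((n : ℝ) + 3 / 2) / 2 * ac (angle n s) + Real.pi / 4)| ≤ E / n ∧
        |v + Real.sin (((n : ℝ) + 3 / 2) / 2 * ac (angle n s) + Real.pi / 4)| ≤ E / n := by
  set E := 22 / ε ^ 5 * Real.exp (22 / ε ^ 5) with hE
  have hE0 : 0 < E := by positivity
  refine ⟨E, hE0, fun n hn => ?_⟩
  have hn1 : (1 : ℝ) ≤ n := by exact_mod_cast hn
  have hKp : 0 < (n : ℝ) + 3 / 2 := by positivity
  have hy0 : 0 < (n : ℝ) + 3 / 2 - (0 : ℝ) ^ 2 / 4 := by simpa using hKp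
  obtain ⟨R, hR, hR0, hR1, hR2⟩ := exists_amplitude n hn _ (lgAmp_pos hy0)
    (by simpa using lgAmp_pow_four hy0)
  refine ⟨R, hR, hR2, fun s hs => ?_⟩
  have hε1 := bulk_eps_le_one hn hs
  obtain ⟨hsc, hcos, hsin, -⟩ := bulk_angle hε hn hs
  obtain ⟨hy, hf2⟩ := lgAmp_sq_bulk hε hn hs
  have hphase := lgPhase_bulk hε hn hs
  have hf := lgAmp_pos hy
  set f := lgAmp ((n : ℝ) + 3 / 2) s with hfdef
  set σ := Real.sqrt ((n : ℝ) + 3 / 2) with hσdef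
  have hσ : 0 < σ := Real.sqrt_pos.2 hKp
  have hσ2 : σ ^ 2 = (n : ℝ) + 3 / 2 := Real.sq_sqrt hKp.le
  have hs0 : 0 < s := by rw [hsc]; have : 0 < Real.cos (angle n s) := by linarith
                         positivity
  have hs2σ : s ≤ 2 * σ := by
    rw [hsc]; nlinarith [Real.cos_le_one (angle n s)]
  have hfle : f ^ 2 ≤ 2 / (σ * ε) := by
    rw [hf2, inv_le_comm₀ (by have : 0 < Real.sin (angle n s) := by linarith
                              positivity) (by positivity), inv_div]
    nlinarith
  have hrate : lgRate ((n : ℝ) + 3 / 2) s * s *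
      Real.exp (lgRate ((n : ℝ) + 3 / 2) s * s) ≤ E / n := by
    have h1 : lgRate ((n : ℝ) + 3 / 2) s * s ≤ 22 / (σ ^ 2 * ε ^ 5) :=
      lgRate_mul_le hσ hε hε1 hs0.le hs2σ hfle
    have h2 : 22 / (σ ^ 2 * ε ^ 5) ≤ 22 / ε ^ 5 / n := by
      rw [div_div, mul_comm, hσ2]
      gcongr
      linarith
    have h3 : 22 / ε ^ 5 / n ≤ 22 / ε ^ 5 := div_le_self (by positivity) hn1
    have h4 : 0 ≤ lgRate ((n : ℝ) + 3 / 2) s := by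
      rw [lgRate, ← hfdef]; positivity
    calc _ ≤ 22 / ε ^ 5 / n * Real.exp (22 / ε ^ 5) := by
          gcongr
          · exact h1.trans h2
          · exact h1.trans (h2.trans h3)
      _ = E / n := by rw [hE]; ring
  have hK' : ((n + 1 : ℕ) : ℝ) + 1 / 2 = (n : ℝ) + 3 / 2 := by push_cast; ring
  obtain ⟨hx, hv⟩ := lg_approx hs0.le hy (hasDerivAt_hermiteFun (n + 1))
    (fun x => hK' ▸ hasDerivAt_hermiteFunDeriv (n + 1) x) hR
    (by rw [hermiteFun_zero]; exact hR0) (by rw [hermiteFunDeriv_zero]; exact hR1) hrate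
  rw [hphase] at hx hv
  refine ⟨hermiteFun (n + 1) s / f / R,
    (f * hermiteFunDeriv (n + 1) s - s / 8 * f ^ 5 * hermiteFun (n + 1) s) / R, ?_, ?_, hx, hv⟩
  · field_simp
  · field_simp; ring

/-- The bound `cos θ · x - sin θ · v ≈ cos (Φ - θ)` for `x ≈ cos Φ` and `v ≈ -sin Φ`. -/
theorem abs_shifted_sub_cos_le {θ Φ x v η δ M : ℝ} (hx : |x - Real.cos Φ| ≤ δ)
    (hv : |v + Real.sin Φ| ≤ δ) (hxM : |x| ≤ M) :
    |Real.cos θ * x - Real.sin θ * v + η * x - Real.cos (Φ - θ)| ≤ 2 * δ + |η| * M := by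
  have h1 : Real.cos θ * x - Real.sin θ * v + η * x - Real.cos (Φ - θ) =
      Real.cos θ * (x - Real.cos Φ) - Real.sin θ * (v + Real.sin Φ) + η * x := by
    rw [Real.cos_sub]; ring
  rw [h1]
  exact abs_mul_add_le (Real.abs_cos_le_one θ) (Real.abs_sin_le_one θ) hx hv hxM

/-- Bounds the contribution of `He_n / s` to the odd case, with `N = n`, `p = σ/s` and `d = sin θ`.
-/
theorem abs_quotient_le {p f x v d ε N M : ℝ} (hε : 0 < ε) (hN : 0 < N) (hd : |d| ≤ 1)
    (hp0 : 0 ≤ p) (hp : p ≤ 2 / ε) (hf : f ^ 4 ≤ 8 / ε ^ 2) (hx : |x| ≤ M) (hv : |v| ≤ M) :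
    |(p * d * v + f ^ 4 / 8 * x + 1 / 2 * x) / (N + 1)| ≤
      (2 / ε / N + 1 / ε ^ 2 / N + 1 / N) * M := by
  have hM : 0 ≤ M := (abs_nonneg _).trans hx
  have h2 : |p * d * v| ≤ 2 / ε * M := by
    rw [abs_mul, abs_mul, abs_of_nonneg hp0]
    calc p * |d| * |v| ≤ 2 / ε * 1 * M := by gcongr
      _ = _ := by ring
  have h3 : |f ^ 4 / 8 * x| ≤ 1 / ε ^ 2 * M := by
    rw [abs_mul, abs_of_nonneg (a := f ^ 4 / 8) (by positivity)]
    have h7 : f ^ 4 / 8 ≤ 1 / ε ^ 2 := by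
      rw [div_le_iff₀ (by norm_num)]
      exact hf.trans_eq (by ring)
    exact mul_le_mul h7 hx (abs_nonneg _) (by positivity)
  have h4 : |1 / 2 * x| ≤ 1 * M := by
    rw [abs_mul]
    gcongr
    rw [abs_of_pos] <;> norm_num
  have h6 := abs_add_three (p * d * v) (f ^ 4 / 8 * x) (1 / 2 * x)
  rw [abs_div, abs_of_pos (a := N + 1) (by positivity)]
  calc |p * d * v + f ^ 4 / 8 * x + 1 / 2 * x| / (N + 1)
      ≤ ((2 / ε + 1 / ε ^ 2 + 1) * M) / N := by
        gcongr
        · linarith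
        · linarith
    _ = _ := by ring

theorem add_lower_order_eq {s σ : ℝ} (hs : s ≠ 0) (hσ : σ ≠ 0) (A η x f R : ℝ) :
    (A - η * x) * (f * R * σ) + x * (f * R) / s =
      (A + (-η + 1 / s / σ) * x) * (f * R * σ) := by
  field_simp; ring

theorem add_quotient_eq {s N : ℝ} (hs : s ≠ 0) (hN : N ≠ 0) (x A B F : ℝ) :
    x * F + (s / 2 * (x * F) + (A + B) * F) / N / s =
      (x + (A + B + s / 2 * x) / (N * s)) * F := by
  field_simp; ring

theorem quotient_eq {s N : ℝ} (hs : s ≠ 0) (hN : N ≠ 0) (x c σ d v F : ℝ) :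
    x + (σ * d * v + s / 8 * F * x + s / 2 * x) / (N * s) - c =
      (x - c) + (σ / s * d * v + F / 8 * x + 1 / 2 * x) / N := by
  field_simp; ring

set_option maxHeartbeats 1000000 in
/-- Asymptotics of the generalized Hermite polynomials in the bulk. -/
theorem exists_bulk_asymptotics {ε : ℝ} (hε : 0 < ε) : ∃ D : ℝ, 0 < D ∧ ∀ n : ℕ, 1 ≤ n →
    ∃ R : ℝ, 0 < R ∧ |R ^ 2 / normSq n - Real.sqrt (2 / Real.pi)| ≤ 4 / (n : ℝ) ∧
      ∀ s ∈ Set.Icc (ε * Real.sqrt n) ((2 - ε) * Real.sqrt n), ∃ a b : ℝ,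
        (genHermite n).eval s * Real.exp (-s ^ 2 / 4) * s =
          a * (lgAmp ((n : ℝ) + 3 / 2) s * R) ∧
        (genHermite (n + 1)).eval s * Real.exp (-s ^ 2 / 4) * s =
          b * (lgAmp ((n : ℝ) + 3 / 2) s * R * Real.sqrt ((n : ℝ) + 3 / 2)) ∧
        |a - Real.cos (((n : ℝ) + 3 / 2) / 2 * ac (angle n s) + Real.pi / 4)| ≤ D / n ∧
        |b - Real.cos (((n : ℝ) + 3 / 2) / 2 * ac (angle n s) + Real.pi / 4 - angle n s)| ≤
          D / n := by
  obtain ⟨E, hE0, hmain⟩ := exists_hermiteFun_asymptotics hε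
  refine ⟨2 * E + (2 / ε + 1 / ε ^ 2 + 1) * (1 + E), by positivity, fun n hn => ?_⟩
  have hn1 : (1 : ℝ) ≤ n := by exact_mod_cast hn
  have hKp : 0 < (n : ℝ) + 3 / 2 := by positivity
  obtain ⟨R, hR, hR2, hmain⟩ := hmain n hn
  refine ⟨R, hR, hR2, fun s hs => ?_⟩
  obtain ⟨x, v, hw, hw', hx, hv⟩ := hmain s hs
  have hε1 := bulk_eps_le_one hn hs
  obtain ⟨hsc, hcos, hsin, -⟩ := bulk_angle hε hn hs
  obtain ⟨hy, hf2⟩ := lgAmp_sq_bulk hε hn hs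
  have hf := lgAmp_pos hy
  set f := lgAmp ((n : ℝ) + 3 / 2) s with hfdef
  set σ := Real.sqrt ((n : ℝ) + 3 / 2) with hσdef
  have hσ : 0 < σ := Real.sqrt_pos.2 hKp
  have hσ2 : σ ^ 2 = (n : ℝ) + 3 / 2 := Real.sq_sqrt hKp.le
  set θ := angle n s with hθ
  set Φ := ((n : ℝ) + 3 / 2) / 2 * ac θ + Real.pi / 4 with hΦ
  have hs0 : 0 < s := by rw [hsc]; have : 0 < Real.cos θ := by linarith
                         positivity
  have hs2σ : s ≤ 2 * σ := by
    rw [hsc]; nlinarith [Real.cos_le_one θ]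
  have hfle : f ^ 2 ≤ 2 / (σ * ε) := by
    rw [hf2, inv_le_comm₀ (by have : 0 < Real.sin θ := by linarith
                              positivity) (by positivity), inv_div]
    nlinarith
  have hf2i : 1 / f ^ 2 = σ * Real.sin θ := by rw [hf2, one_div, inv_inv]
  have hEn : E / n ≤ E := div_le_self hE0.le hn1
  have hxM : |x| ≤ 1 + E := by
    have := abs_sub_abs_le_abs_sub x (Real.cos Φ)
    linarith [Real.abs_cos_le_one Φ]
  have hvM : |v| ≤ 1 + E := by
    have := abs_sub_abs_le_abs_sub v (-Real.sin Φ)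
    rw [abs_neg, sub_neg_eq_add] at this
    linarith [Real.abs_sin_le_one Φ]
  have hf4 : f ^ 4 ≤ 4 / (σ ^ 2 * ε ^ 2) := by
    calc f ^ 4 = (f ^ 2) ^ 2 := by ring
      _ ≤ (2 / (σ * ε)) ^ 2 := by gcongr
      _ = _ := by ring
  have hsf : s / 8 * f ^ 4 / σ ≤ 1 / ε ^ 2 / n := by
    calc s / 8 * f ^ 4 / σ ≤ 2 * σ / 8 * (4 / (σ ^ 2 * ε ^ 2)) / σ := by gcongr
      _ = 1 / (σ ^ 2 * ε ^ 2) := by field_simp; ring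
      _ ≤ 1 / (n * ε ^ 2) := by
        rw [hσ2]; gcongr; linarith
      _ = _ := by rw [div_div, mul_comm]
  have hσs : σ / s ≤ 2 / ε := by
    rw [div_le_div_iff₀ hs0 hε, hsc]
    nlinarith
  have hss : 1 / s / σ ≤ 2 / ε / n := by
    calc 1 / s / σ = σ / s / σ ^ 2 := by field_simp
      _ ≤ 2 / ε / n := by
        rw [hσ2]; gcongr; linarith
  have hsf0 : 0 ≤ s / 8 * f ^ 4 / σ := by positivity
  have hss0 : 0 ≤ 1 / s / σ := by positivity
  have hcosσ : s / 2 / σ = Real.cos θ := by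
    rw [hsc]; field_simp
  -- The raising relation with `s/2 = σ cos θ` and `1/f² = σ sin θ` produces `cos θ cos Φ + sin θ
  -- sin Φ`, hence the phase shift by `θ`.
  have hnext : hermiteFun (n + 2) s =
      (Real.cos θ * x - Real.sin θ * v - s / 8 * f ^ 4 / σ * x) * (f * R * σ) := by
    rw [show n + 2 = n + 1 + 1 by ring, hermiteFun_succ, hw, hw', ← hcosσ]
    have h1 : v / f ^ 2 = σ * Real.sin θ * v := by rw [← hf2i]; ring
    rw [h1]; field_simp; ring
  have hsplit : (2 * E + (2 / ε + 1 / ε ^ 2 + 1) * (1 + E)) / n =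
      2 * (E / n) + (2 / ε / n + 1 / ε ^ 2 / n + 1 / n) * (1 + E) := by ring
  have hn0 : 0 < 1 / (n : ℝ) := by positivity
  have hεn : 0 < 2 / ε / n := by positivity
  have hε2n : 0 < 1 / ε ^ 2 / n := by positivity
  have hE1 : 0 < 1 + E := by linarith
  rw [hsplit]
  -- Exactly one of `n`, `n + 1` is odd, and only that polynomial carries the extra term divided by
  -- `s`. This term has relative size `O(1/n)` in both cases.
  rcases Nat.even_or_odd n with he | ho
  · refine ⟨x, Real.cos θ * x - Real.sin θ * v + (-(s / 8 * f ^ 4 / σ) + 1 / s / σ) * x,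
      ?_, ?_, ?_, ?_⟩
    · rw [mul_genHermite_of_even he, hw]
    · rw [mul_genHermite_of_odd he.add_one hs0.ne', hnext, hw]
      exact add_lower_order_eq hs0.ne' hσ.ne' _ _ _ _ _
    · refine hx.trans ?_
      have : 0 < E / n := by positivity
      have : 0 < (2 / ε / n + 1 / ε ^ 2 / n + 1 / n) * (1 + E) := by positivity
      linarith
    · refine (abs_shifted_sub_cos_le hx hv hxM).trans ?_
      have : |-(s / 8 * f ^ 4 / σ) + 1 / s / σ| ≤ 2 / ε / n + 1 / ε ^ 2 / n + 1 / n := by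
        rw [abs_le]; constructor <;> linarith
      gcongr
  · refine ⟨x + (σ * Real.sin θ * v + s / 8 * f ^ 4 * x + s / 2 * x) / ((n + 1) * s),
      Real.cos θ * x - Real.sin θ * v + (-(s / 8 * f ^ 4 / σ)) * x, ?_, ?_, ?_, ?_⟩
    · have h1 := hermiteFun_pred n s
      have h2 : hermiteFun n s =
          (s / 2 * hermiteFun (n + 1) s + hermiteFunDeriv (n + 1) s) / (n + 1) := by
        rw [eq_div_iff (by positivity)]; linarith
      have h3 : v / f ^ 2 = σ * Real.sin θ * v := by rw [← hf2i]; ring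
      rw [mul_genHermite_of_odd ho hs0.ne', h2, hw, hw', h3]
      exact add_quotient_eq hs0.ne' (by positivity) _ _ _ _
    · rw [mul_genHermite_of_even ho.add_one, hnext]
      ring
    · have h1 := quotient_eq hs0.ne' (by positivity : (n : ℝ) + 1 ≠ 0) x (Real.cos Φ) σ
        (Real.sin θ) v (f ^ 4)
      have hf8 : f ^ 4 ≤ 8 / ε ^ 2 := by
        calc f ^ 4 ≤ 4 / (σ ^ 2 * ε ^ 2) := hf4
          _ ≤ 8 / (1 * ε ^ 2) := by
            gcongr
            · norm_num
            · rw [hσ2]; linarith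
          _ = _ := by rw [one_mul]
      have h5 := abs_quotient_le hε (by linarith : (0 : ℝ) < n) (Real.abs_sin_le_one θ)
        (by positivity) hσs hf8 hxM hvM
      rw [h1]
      refine (abs_add_le _ _).trans ?_
      have : 0 < E / n := by positivity
      linarith
    · refine (abs_shifted_sub_cos_le hx hv hxM).trans ?_
      have : |-(s / 8 * f ^ 4 / σ)| ≤ 2 / ε / n + 1 / ε ^ 2 / n + 1 / n := by
        rw [abs_le]; constructor <;> linarith
      gcongr

end Bulk

/-! ### The kernels `ρ_n` and `δ_n` -/

section Kernel

theorem two_mul_cos_mul_cos_eq (u v : ℝ) :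
    2 * (Real.cos u * Real.cos v) = Real.cos (u - v) + Real.cos (u + v) := by
  rw [Real.cos_sub, Real.cos_add]; ring

/-- The oscillatory factor as a difference of products. -/
theorem oscillation_eq (n : ℕ) (φ ψ : ℝ) :
    Real.cos (daleth n φ ψ - φ) - Real.cos (daleth n φ ψ + ψ)
      + Real.sin (shin n φ ψ - ψ) - Real.sin (shin n φ ψ - φ) =
    2 * (Real.cos (((n : ℝ) + 3 / 2) / 2 * ac φ + Real.pi / 4 - φ) *
        Real.cos (((n : ℝ) + 3 / 2) / 2 * ac ψ + Real.pi / 4) -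
      Real.cos (((n : ℝ) + 3 / 2) / 2 * ac φ + Real.pi / 4) *
        Real.cos (((n : ℝ) + 3 / 2) / 2 * ac ψ + Real.pi / 4 - ψ)) := by
  rw [mul_sub, two_mul_cos_mul_cos_eq, two_mul_cos_mul_cos_eq, daleth, shin]
  set A := ((n : ℝ) + 3 / 2) / 2 * ac φ with hA
  set B := ((n : ℝ) + 3 / 2) / 2 * ac ψ with hB
  rw [show A + Real.pi / 4 - φ + (B + Real.pi / 4) = A + B - φ + Real.pi / 2 by ring,
    show A + Real.pi / 4 + (B + Real.pi / 4 - ψ) = A + B - ψ + Real.pi / 2 by ring,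
    Real.cos_add_pi_div_two, Real.cos_add_pi_div_two, mul_sub, mul_add, ← hA, ← hB]
  ring_nf

theorem abs_mul_sub_mul_le {a b p q δ M : ℝ} (ha : |a - p| ≤ δ) (hb : |b - q| ≤ δ)
    (hbM : |b| ≤ M) (hp : |p| ≤ 1) : |a * b - p * q| ≤ δ * M + δ := by
  have h1 : a * b - p * q = (a - p) * b + p * (b - q) := by ring
  have h2 : |(a - p) * b| ≤ δ * M := by
    rw [abs_mul]; exact mul_le_mul ha hbM (abs_nonneg _) ((abs_nonneg _).trans ha)
  have h3 : |p * (b - q)| ≤ 1 * δ := by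
    rw [abs_mul]; exact mul_le_mul hp hb (abs_nonneg _) zero_le_one
  rw [h1]
  have := abs_add_le ((a - p) * b) (p * (b - q))
  linarith

theorem half_le_sqrt_two_div_pi : 1 / 2 ≤ Real.sqrt (2 / Real.pi) := by
  refine (Real.le_sqrt (by norm_num) (by positivity)).2 ?_
  rw [le_div_iff₀ Real.pi_pos]; linarith [Real.pi_le_four]

theorem sqrt_two_div_pi_le_one : Real.sqrt (2 / Real.pi) ≤ 1 := by
  rw [← Real.sqrt_one]
  refine Real.sqrt_le_sqrt ?_
  rw [div_le_one Real.pi_pos]; exact Real.two_le_pi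

/-- Separates the error of the normalization `γ = R² / h_n` against `g = √(2/π)` from that of the
oscillating factor. The first costs `(4/N) · 2 · 4M²`, hence the `32`. -/
theorem remainder_le {γ g T E N M D : ℝ} (hN : 1 ≤ N) (hg : 1 / 2 ≤ g) (hγ : |γ - g| ≤ 4 / N)
    (hT : |T| ≤ 2 * M ^ 2) (hTE : |2 * T - E| ≤ D / N) :
    |γ / g * (2 * T) - E| ≤ (D + 32 * M ^ 2) / N := by
  have h1 : γ / g * (2 * T) - E = (γ - g) / g * (2 * T) + (2 * T - E) := by
    field_simp; ring
  have h2 : |(γ - g) / g * (2 * T)| ≤ 4 / N / (1 / 2) * (2 * (2 * M ^ 2)) := by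
    rw [abs_mul, abs_div, abs_mul, abs_of_pos (a := g) (by linarith), abs_two]
    gcongr
  rw [h1]
  refine (abs_add_le _ _).trans ?_
  have h3 : (D + 32 * M ^ 2) / N = 4 / N / (1 / 2) * (2 * (2 * M ^ 2)) + D / N := by ring
  linarith

theorem prefactor_eq {σ H g c c' q : ℝ} (hσ : σ ≠ 0) (hH : H ≠ 0) (hg : g ≠ 0) (hc : c - c' ≠ 0)
    (hc1 : c ≠ 0) (hc2 : c' ≠ 0) (hq : q ≠ 0) (T R : ℝ) :
    -T * (R ^ 2 / q) / (4 * σ ^ 2 * (c * c')) / (H * -(2 * σ * (c - c'))) =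
      g * (1 / 8) * (1 / σ ^ 3) * (1 / ((c - c') * c * c' * q)) * (1 / 2) *
        (R ^ 2 / H / g * (2 * T)) := by
  field_simp
  ring

set_option maxHeartbeats 1000000 in
/-- Bulk asymptotics of the kernel `ρ_n` and the bound for `δ_n`. -/
theorem kernel_asymptotics {ε : ℝ} (hε : 0 < ε) :
    ∃ C : ℝ, ∀ n : ℕ, 1 ≤ n →
      ∀ s ∈ Set.Icc (ε * Real.sqrt n) ((2 - ε) * Real.sqrt n),
      ∀ t ∈ Set.Icc (ε * Real.sqrt n) ((2 - ε) * Real.sqrt n), s ≠ t →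
        (∃ r : ℝ, |r| ≤ C / Real.sqrt n ∧
            rho n s t * Real.exp (-(s ^ 2 + t ^ 2) / 4) =
              Real.sqrt (2 / Real.pi) * (1 / 8) * ((n : ℝ) + 3 / 2) ^ (-(3 / 2) : ℝ) *
                (1 / ((Real.cos (angle n s) - Real.cos (angle n t)) * Real.cos (angle n s) *
                  Real.cos (angle n t) *
                  Real.sqrt (Real.sin (angle n s) * Real.sin (angle n t)))) *
                (1 / 2) *
                (Real.cos (daleth n (angle n s) (angle n t) - angle n s)
                  - Real.cos (daleth n (angle n s) (angle n t) + angle n t)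
                  + Real.sin (shin n (angle n s) (angle n t) - angle n t)
                  - Real.sin (shin n (angle n s) (angle n t) - angle n s) + r)) ∧
        |delta n s t * Real.exp (-(s ^ 2 + t ^ 2) / 4)| ≤ C / n := by
  obtain ⟨D, hD, hmain⟩ := exists_bulk_asymptotics hε
  set M := 1 + D with hM
  set C₁ := 4 * (D * M + D) + 32 * M ^ 2 with hC₁
  set C₂ := 5 * (1 / (ε / 2)) * (1 / (2 * ε ^ 3)) * (2 * M ^ 2) with hC₂
  have hM0 : 0 < M := by positivity
  have hC₁0 : 0 < C₁ := by positivity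
  have hC₂0 : 0 < C₂ := by positivity
  refine ⟨C₁ + C₂, fun n hn s hs t ht hst => ?_⟩
  have hn1 : (1 : ℝ) ≤ n := by exact_mod_cast hn
  obtain ⟨R, hR, hRγ, hQ⟩ := hmain n hn
  obtain ⟨a, b, hQs, hQs', ha, hb⟩ := hQ s hs
  obtain ⟨a', b', hQt, hQt', ha', hb'⟩ := hQ t ht
  obtain ⟨hsc, hcs, hss, -⟩ := bulk_angle hε hn hs
  obtain ⟨htc, hct, hts, -⟩ := bulk_angle hε hn ht
  obtain ⟨hys, hfs⟩ := lgAmp_sq_bulk hε hn hs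
  obtain ⟨hyt, hft⟩ := lgAmp_sq_bulk hε hn ht
  have hfs0 := lgAmp_pos hys
  have hft0 := lgAmp_pos hyt
  have hosc := oscillation_eq n (angle n s) (angle n t)
  have hKp : 0 < (n : ℝ) + 3 / 2 := by positivity
  set K := (n : ℝ) + 3 / 2 with hK
  set f := lgAmp K s with hf
  set f' := lgAmp K t with hf'
  set σ := Real.sqrt K with hσdef
  have hσ : 0 < σ := Real.sqrt_pos.2 hKp
  set φ := angle n s with hφ
  set ψ := angle n t with hψ
  set Φ := K / 2 * ac φ + Real.pi / 4 with hΦ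
  set Ψ := K / 2 * ac ψ + Real.pi / 4 with hΨ
  have hcφ : 0 < Real.cos φ := by linarith
  have hcψ : 0 < Real.cos ψ := by linarith
  have hsφ : 0 < Real.sin φ := by linarith
  have hsψ : 0 < Real.sin ψ := by linarith
  have hs0 : 0 < s := by rw [hsc]; positivity
  have ht0 : 0 < t := by rw [htc]; positivity
  have hh := normSq_pos n
  set γ := R ^ 2 / normSq n with hγ
  have hγ0 : 0 < γ := by positivity
  set q := Real.sqrt (Real.sin φ * Real.sin ψ) with hq
  have hq0 : 0 < q := Real.sqrt_pos.2 (by positivity)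
  have hq2 : q ^ 2 = Real.sin φ * Real.sin ψ := Real.sq_sqrt (by positivity)
  have hff : f * f' = 1 / (σ * q) := by
    refine (pow_left_inj₀ (by positivity) (by positivity) two_ne_zero).1 ?_
    rw [mul_pow, hfs, hft, div_pow, mul_pow, hq2, one_pow, ← mul_inv, one_div]
    congr 1
    ring
  have hexp : Real.exp (-(s ^ 2 + t ^ 2) / 4) =
      Real.exp (-s ^ 2 / 4) * Real.exp (-t ^ 2 / 4) := by
    rw [← Real.exp_add]; ring_nf
  have hpow : K ^ (-(3 / 2) : ℝ) = 1 / σ ^ 3 := by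
    rw [hσdef, Real.sqrt_eq_rpow, ← Real.rpow_mul_natCast hKp.le, Real.rpow_neg hKp.le, one_div]
    norm_num
  clear_value f f' σ φ ψ Φ Ψ γ M C₁ C₂
  -- The asymptotics concern `s Q(s)` and `t Q(t)`, so each product acquires the denominator `s t`;
  -- this yields `cos φ cos ψ` in the prefactor.
  have hQQ : ∀ x y z w c d : ℝ, x * Real.exp (-s ^ 2 / 4) * s = c * z →
      y * Real.exp (-t ^ 2 / 4) * t = d * w →
      x * y * Real.exp (-(s ^ 2 + t ^ 2) / 4) = c * d * (z * w) / (s * t) := by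
    intro x y z w c d h1 h2
    rw [hexp, eq_div_iff (by positivity)]
    calc _ = (x * Real.exp (-s ^ 2 / 4) * s) * (y * Real.exp (-t ^ 2 / 4) * t) := by ring
      _ = _ := by rw [h1, h2]; ring
  have hQ1 := hQQ _ _ _ _ _ _ hQs hQt'
  have hQ2 := hQQ _ _ _ _ _ _ hQs' hQt
  have hz1 : f * R * (f' * R * σ) = R ^ 2 / q := by
    calc _ = (f * f') * R ^ 2 * σ := by ring
      _ = _ := by rw [hff]; field_simp
  have hz2 : f * R * σ * (f' * R) = R ^ 2 / q := by
    calc _ = (f * f') * R ^ 2 * σ := by ring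
      _ = _ := by rw [hff]; field_simp
  rw [hz1] at hQ1
  rw [hz2] at hQ2
  have hDn : D / n ≤ D := div_le_self hD.le hn1
  have hMle : ∀ x c : ℝ, |x - Real.cos c| ≤ D / n → |x| ≤ M := by
    intro x c hx
    have := abs_sub_abs_le_abs_sub x (Real.cos c)
    linarith [Real.abs_cos_le_one c]
  have haM := hMle _ _ ha
  have hbM := hMle _ _ hb
  have haM' := hMle _ _ ha'
  have hbM' := hMle _ _ hb'
  have hprod : ∀ x y : ℝ, |x| ≤ M → |y| ≤ M → |x * y| ≤ M ^ 2 := by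
    intro x y hx hy
    rw [abs_mul, sq]; exact mul_le_mul hx hy (abs_nonneg _) hM0.le
  have hp1 := hprod _ _ haM hbM'
  have hp2 := hprod _ _ hbM haM'
  have hg := half_le_sqrt_two_div_pi
  constructor
  · set T := b * a' - a * b' with hT
    have hTM : |T| ≤ 2 * M ^ 2 := by
      have := abs_sub (b * a') (a * b')
      linarith
    -- The remainder is chosen to make the formula exact, so that only its size needs an estimate.
    refine ⟨γ / Real.sqrt (2 / Real.pi) * (2 * T) - (Real.cos (daleth n φ ψ - φ)
      - Real.cos (daleth n φ ψ + ψ) + Real.sin (shin n φ ψ - ψ) - Real.sin (shin n φ ψ - φ)),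
      ?_, ?_⟩
    · have h1 : |γ / Real.sqrt (2 / Real.pi) * (2 * T) - (Real.cos (daleth n φ ψ - φ)
          - Real.cos (daleth n φ ψ + ψ) + Real.sin (shin n φ ψ - ψ)
          - Real.sin (shin n φ ψ - φ))| ≤ C₁ / n := by
        rw [hC₁]
        refine remainder_le hn1 hg hRγ hTM ?_
        have h2 := abs_mul_sub_mul_le hb ha' haM' (Real.abs_cos_le_one _)
        have h3 := abs_mul_sub_mul_le ha hb' hbM' (Real.abs_cos_le_one _)
        rw [hosc, hT, abs_le]
        rw [abs_le] at h2 h3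
        have h4 : 4 * (D * M + D) / n = 4 * (D / n * M + D / n) := by ring
        rw [h4]
        constructor <;> linarith
      refine h1.trans ?_
      -- The remainder is in fact `O(1/n)`; it is weakened to the stated rate.
      have h5 : Real.sqrt n ≤ n :=
        Real.sqrt_le_iff.2 ⟨by linarith, le_self_pow₀ hn1 two_ne_zero⟩
      have h6 : 0 < Real.sqrt n := Real.sqrt_pos.2 (by linarith)
      gcongr
      linarith
    · rw [add_sub_cancel, rho, Q_eq_genHermite, Q_eq_genHermite, h_eq_normSq, hpow]
      have hne : Real.cos φ - Real.cos ψ ≠ 0 := by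
        intro h0
        refine hst ?_
        rw [hsc, htc, sub_eq_zero.1 h0]
      have h1 : ((genHermite n).eval s * (genHermite (n + 1)).eval t -
          (genHermite (n + 1)).eval s * (genHermite n).eval t) *
            Real.exp (-(s ^ 2 + t ^ 2) / 4) = -T * (R ^ 2 / q) / (s * t) := by
        rw [sub_mul, hQ1, hQ2, hT]; ring
      have hts : t - s = -(2 * σ * (Real.cos φ - Real.cos ψ)) := by
        rw [hsc, htc]; ring
      have hst' : s * t = 4 * σ ^ 2 * (Real.cos φ * Real.cos ψ) := by
        rw [hsc, htc]; ring
      rw [div_mul_eq_mul_div, h1, hts, hst', hγ]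
      exact prefactor_eq hσ.ne' hh.ne' (by linarith) hne hcφ.ne' hcψ.ne' hq0.ne' T R
  · have h1 : ((genHermite n).eval s * (genHermite (n + 1)).eval t +
        (genHermite (n + 1)).eval s * (genHermite n).eval t) *
          Real.exp (-(s ^ 2 + t ^ 2) / 4) = (a * b' + b * a') * (R ^ 2 / q) / (s * t) := by
      rw [add_mul, hQ1, hQ2]; ring
    have h2 : delta n s t * Real.exp (-(s ^ 2 + t ^ 2) / 4) =
        γ * (1 / q) * (1 / (s * t * (t + s))) * (a * b' + b * a') := by
      rw [delta, Q_eq_genHermite, Q_eq_genHermite, h_eq_normSq, div_mul_eq_mul_div, h1, hγ]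
      field_simp
    have hγ5 : γ ≤ 5 := by
      have h3 := (abs_le.1 hRγ).2
      have h4 : 4 / (n : ℝ) ≤ 4 := div_le_self (by norm_num) hn1
      linarith [sqrt_two_div_pi_le_one]
    have hqε : ε / 2 ≤ q := by
      refine (Real.le_sqrt (by positivity) (by positivity)).2 ?_
      rw [sq]
      gcongr
    have h6 : Real.sqrt n ^ 2 = n := Real.sq_sqrt (by linarith)
    have h7 : 1 ≤ Real.sqrt n := Real.one_le_sqrt.2 hn1
    -- The product is at least `2 ε³ n^{3/2}`; a factor `√n ≥ 1` is given away.
    have hstt : 2 * ε ^ 3 * n ≤ s * t * (t + s) := by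
      calc 2 * ε ^ 3 * n ≤ 2 * ε ^ 3 * (Real.sqrt n ^ 2 * Real.sqrt n) := by
            rw [h6]
            gcongr
            exact le_mul_of_one_le_right (by linarith) h7
        _ = (ε * Real.sqrt n) * (ε * Real.sqrt n) * (ε * Real.sqrt n + ε * Real.sqrt n) := by ring
        _ ≤ s * t * (t + s) := by
          have := hs.1
          have := ht.1
          gcongr
    have h8 : |a * b' + b * a'| ≤ 2 * M ^ 2 := by
      have := abs_add_le (a * b') (b * a')
      linarith
    rw [h2, abs_mul, abs_of_pos (a := γ * (1 / q) * (1 / (s * t * (t + s)))) (by positivity)]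
    calc γ * (1 / q) * (1 / (s * t * (t + s))) * |a * b' + b * a'|
        ≤ 5 * (1 / (ε / 2)) * (1 / (2 * ε ^ 3 * n)) * (2 * M ^ 2) := by gcongr
      _ = C₂ / n := by rw [hC₂]; field_simp
      _ ≤ (C₁ + C₂) / n := by gcongr; linarith

end Kernel

end Ginibre3D

open Ginibre3D in
theorem mainTheorem5 (ε : ℝ) (hε : 0 < ε) :
    ∃ C : ℝ, ∀ n : ℕ, 1 ≤ n →
      ∀ s ∈ Set.Icc (ε * Real.sqrt n) ((2 - ε) * Real.sqrt n),
      ∀ t ∈ Set.Icc (ε * Real.sqrt n) ((2 - ε) * Real.sqrt n), s ≠ t →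
        (∀ φ ψ : ℝ, φ = angle n s → ψ = angle n t →
          ∃ r : ℝ, |r| ≤ C / Real.sqrt n ∧
            rho n s t * Real.exp (-(s ^ 2 + t ^ 2) / 4) =
              Real.sqrt (2 / Real.pi) * (1 / 8) * ((n : ℝ) + 3 / 2) ^ (-(3 / 2) : ℝ) *
                (1 / ((Real.cos φ - Real.cos ψ) * Real.cos φ * Real.cos ψ *
                  Real.sqrt (Real.sin φ * Real.sin ψ))) *
                (1 / 2) *
                (Real.cos (daleth n φ ψ - φ) - Real.cos (daleth n φ ψ + ψ)
                  + Real.sin (shin n φ ψ - ψ) - Real.sin (shin n φ ψ - φ) + r)) ∧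
        |delta n s t * Real.exp (-(s ^ 2 + t ^ 2) / 4)| ≤ C / n := by
  obtain ⟨C, hC⟩ := kernel_asymptotics hε
  refine ⟨C, fun n hn s hs t ht hst => ⟨?_, (hC n hn s hs t ht hst).2⟩⟩
  rintro φ ψ rfl rfl
  exact (hC n hn s hs t ht hst).1
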